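/- Definitions. For $C, W \subseteq \mathbb{N}$ write $C \subseteq^* W$ if $C \setminus W$ is finite. An infinite set $C \subseteq \mathbb{N}$ is \emph{cohesive} if for every c.e. set $W$ either $C \subseteq^* W$ or $C \subseteq^* \mathbb{N} \setminus W$. A \emph{computable structure} $\mathcal{A}$ for a finite language $\mathfrak{L}$ consists of a non-empty computable domain $A \subseteq \mathbb{N}$ and computable interpretations of the relation, function and constant symbols of $\mathfrak{L}$. For a cohesive set $C$, the \emph{cohesive power} $\Pi_C \mathcal{A}$ is the $\mathfrak{L}$-structure whose elements are the classes $[\varphi]$ of partial computable functions $\varphi \colon \mathbb{N} \to A$ with $C \subseteq^* \mathrm{dom}(\varphi)$, where $\varphi$ and $\psi$ are identified if $C \subseteq^* \{x : \varphi(x){\downarrow} = \psi(x){\downarrow}\}$. An $n$-ary relation $R([\varphi_0], \dots, [\varphi_{n-1}])$ holds in $\Pi_C\mathcal{A}$ if and only if $C \subseteq^* \{x : \varphi_i(x){\downarrow} \text{ for all } i<n, \text{ and } R^{\mathcal{A}}(\varphi_0(x), \dots, \varphi_{n-1}(x))\}$; $f([\varphi_0], \dots, [\varphi_{n-1}])$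 is the class of $x \mapsto f^{\mathcal{A}}(\varphi_0(x), \dots, \varphi_{n-1}(x))$; and a constant $c$ is interpreted as the class of the constant function with value $c^{\mathcal{A}}$. A structure is \emph{uniformly locally finite} if there is a function $f \colon \mathbb{N} \to \mathbb{N}$ such that every substructure generated by at most $n$ elements has cardinality at most $f(n)$. It is \emph{ultrahomogeneous} if every isomorphism between two finitely generated substructures extends to an automorphism of the structure. Theorem. (1) Let $\mathcal{A}$ be an infinite, uniformly locally finite, ultrahomogeneous computable structure for a finite language, and let $C$ be cohesive. Then $\mathcal{A} \cong \Pi_C \mathcal{A}$. (2) Each of the following structures has a computable presentation (a computable structure isomorphic to it), and every computable presentation $\mathcal{A}$ of it is infinite, uniformly locally finite and ultrahomogeneous, and satisfies $\mathcal{A} \cong \Pi_C \mathcal{A}$ for every cohesive set $C$: (a) the linear order $(\mathbb{Q}, <)$ in the language $\{<\}$; (b) the Rado graph, i.e. the countable simple graph such that for any two disjoint finite sets $U, V$ of vertices there is a vertex outside $U \cup V$ adjacent to every vertex in $U$ and to no vertex in $V$; (c) the countable atomless (nontrivial) Boolean algebra, in the language $\{0, 1, \neg, \wedge, \vee\}$.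 -/

import Mathlib

open FirstOrder FirstOrder.Language

universe u v

/-! ### Cohesive sets -/

/-- `AlmostSubset C W` is `C ⊆* W`: all but finitely many elements of `C` belong to `W`. -/
def AlmostSubset (C W : Set ℕ) : Prop := (C \ W).Finite

theorem AlmostSubset.mono {C W W' : Set ℕ} (h : AlmostSubset C W) (hW : W ⊆ W') :
    AlmostSubset C W' :=
  Set.Finite.subset h fun _ hx => ⟨hx.1, fun hx' => hx.2 (hW hx')⟩

theorem AlmostSubset.inter {C W W' : Set ℕ} (h : AlmostSubset C W) (h' : AlmostSubset C W') :
    AlmostSubset C (W ∩ W') := by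
  refine (Set.Finite.union h h').subset ?_
  rintro x ⟨hx, hn⟩
  by_cases hW : x ∈ W
  · exact Or.inr ⟨hx, fun hW' => hn ⟨hW, hW'⟩⟩
  · exact Or.inl ⟨hx, hW⟩

theorem AlmostSubset.forall_fin {C : Set ℕ} {n : ℕ} {W : Fin n → Set ℕ}
    (h : ∀ i, AlmostSubset C (W i)) : AlmostSubset C {x | ∀ i, x ∈ W i} := by
  refine (Set.finite_iUnion h).subset ?_
  rintro x ⟨hx, hn⟩
  obtain ⟨i, hi⟩ := not_forall.1 hn
  exact Set.mem_iUnion.2 ⟨i, hx, hi⟩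

/-- An infinite set `C` of natural numbers is cohesive if for every c.e. set `W`, either `C ⊆* W`
or `C ⊆* Wᶜ`. -/
def IsCohesive (C : Set ℕ) : Prop :=
  C.Infinite ∧ ∀ W : Set ℕ, REPred (fun x => x ∈ W) → AlmostSubset C W ∨ AlmostSubset C Wᶜ

/-! ### Computable structures -/

/-- A computable structure for a language `L` with finitely many symbols: a nonempty computable
domain `carrier ⊆ ℕ` together with computable interpretations of the symbols of `L`. (As `L` is
finite, uniform computability of the interpretations is the same as computability of each of them;
constants are the function symbols of arity `0`.) -/
structure ComputableStructure (L : FirstOrder.Language.{u, v}) [Finite L.Symbols] where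
  carrier : Set ℕ
  nonempty : carrier.Nonempty
  computable_carrier : ComputablePred fun x : ℕ => x ∈ carrier
  struct : L.Structure carrier
  computable_fun : ∀ {n : ℕ} (f : L.Functions n), ∃ g : (Fin n → ℕ) → ℕ, Computable g ∧
    ∀ a : Fin n → carrier, g (fun i => (a i : ℕ)) = (Structure.funMap f a : carrier)
  computable_rel : ∀ {n : ℕ} (R : L.Relations n), ComputablePred fun a : Fin n → ℕ =>
    ∃ h : ∀ i, a i ∈ carrier, Structure.RelMap R fun i => (⟨a i, h i⟩ : carrier)

instance {L : FirstOrder.Language.{u, v}} [Finite L.Symbols] : CoeSort (ComputableStructure L) Type where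
  coe A := A.carrier

instance {L : FirstOrder.Language.{u, v}} [Finite L.Symbols] (A : ComputableStructure L) :
    L.Structure A := A.struct

/-! ### Cohesive powers -/

namespace CohesivePower

theorem mem_mOfFn {n : ℕ} (p : Fin n → Part ℕ) (v : List.Vector ℕ n) :
    v ∈ List.Vector.mOfFn p ↔ ∀ i, v.get i ∈ p i := by
  induction n with
  | zero => simp [List.Vector.mOfFn, Subsingleton.elim v List.Vector.nil]
  | succ n ih =>
    simp only [List.Vector.mOfFn, Part.bind_eq_bind, Part.mem_bind_iff, Part.pure_eq_some,
      Part.mem_some_iff, Fin.forall_fin_succ]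
    constructor
    · rintro ⟨a, ha, w, hw, rfl⟩
      refine ⟨by simpa using ha, fun i => ?_⟩
      simpa using (ih _ w).1 hw i
    · rintro ⟨h0, hs⟩
      refine ⟨v.head, by simpa using h0, v.tail, (ih _ _).2 fun i => ?_, by simp⟩
      simpa using hs i

variable {L : FirstOrder.Language.{u, v}} [Finite L.Symbols]

/-- The partial computable functions `φ : ℕ → A` with `C ⊆* dom φ`. -/
structure Rep (A : ComputableStructure L) (C : Set ℕ) where
  toFun : ℕ →. ℕ
  partrec : Partrec toFun
  mem_carrier : ∀ x, ∀ y ∈ toFun x, y ∈ A.carrier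
  almost_dom : AlmostSubset C {x | (toFun x).Dom}

variable {A : ComputableStructure L} {C : Set ℕ}

/-- The value `φ x`, as an element of `A`, at a point `x` where `φ` is defined. -/
def Rep.val (φ : Rep A C) (x : ℕ) (h : (φ.toFun x).Dom) : A :=
  ⟨(φ.toFun x).get h, φ.mem_carrier x _ (Part.get_mem h)⟩

/-- The relation `φ =_C ψ`: on almost all `x ∈ C`, both sides are defined and equal. -/
instance setoid (A : ComputableStructure L) (C : Set ℕ) : Setoid (Rep A C) where
  r φ ψ := AlmostSubset C {x | ∃ y, y ∈ φ.toFun x ∧ y ∈ ψ.toFun x}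
  iseqv :=
    { refl := fun φ => φ.almost_dom.mono fun _ hx => ⟨_, Part.get_mem hx, Part.get_mem hx⟩
      symm := fun h => h.mono fun _ ⟨y, h1, h2⟩ => ⟨y, h2, h1⟩
      trans := fun h h' => (h.inter h').mono fun _ ⟨⟨y, h1, h2⟩, ⟨_, h3, h4⟩⟩ =>
        ⟨y, h1, (Part.mem_unique h3 h2) ▸ h4⟩ }

/-- The partial function `x ↦ f(φ₀(x), …, φₙ₋₁(x))`, defined where all of the `φᵢ(x)` are. -/
def applyPart {n : ℕ} (f : L.Functions n) (φ : Fin n → Rep A C) : ℕ →. ℕ := fun x =>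
  ⟨∀ i, ((φ i).toFun x).Dom,
    fun h => ((Structure.funMap f fun i => (φ i).val x (h i) : A) : ℕ)⟩

theorem applyPart_partrec {n : ℕ} (f : L.Functions n) (φ : Fin n → Rep A C) :
    Partrec (applyPart f φ) := by
  obtain ⟨g, hg, hgf⟩ := A.computable_fun f
  have h1 : Partrec fun x : ℕ => List.Vector.mOfFn fun i => (φ i).toFun x :=
    Partrec.vector_mOfFn fun i => (φ i).partrec
  have h2 : Computable fun v : List.Vector ℕ n => g v.get :=
    hg.comp Primrec.vector_get'.to_comp
  refine (h1.map (h2.comp Computable.snd).to₂).of_eq fun x => ?_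
  ext y
  simp only [Part.mem_map_iff, mem_mOfFn]
  constructor
  · rintro ⟨v, hv, rfl⟩
    refine ⟨fun i => Part.dom_iff_mem.2 ⟨_, hv i⟩, ?_⟩
    change ((Structure.funMap f _ : A.carrier) : ℕ) = _
    rw [← hgf]
    congr 1
    funext i
    exact Part.get_eq_of_mem (hv i) _
  · rintro ⟨h, rfl⟩
    refine ⟨List.Vector.ofFn fun i => ((φ i).toFun x).get (h i), fun i => ?_, ?_⟩
    · simpa using Part.get_mem (h i)
    · change _ = ((Structure.funMap f _ : A.carrier) : ℕ)
      rw [← hgf]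
      congr 1
      funext i
      simp [Rep.val]

/-- The representative `x ↦ f(φ₀(x), …, φₙ₋₁(x))`. For `n = 0` it is constant. -/
def apply {n : ℕ} (f : L.Functions n) (φ : Fin n → Rep A C) : Rep A C where
  toFun := applyPart f φ
  partrec := applyPart_partrec f φ
  mem_carrier := by
    rintro x y ⟨h, rfl⟩
    exact Subtype.prop _
  almost_dom := AlmostSubset.forall_fin fun i => (φ i).almost_dom

instance prestructure (A : ComputableStructure L) (C : Set ℕ) : L.Prestructure (setoid A C) where
  toStructure :=
    { funMap := fun f φ => apply f φ
      RelMap := fun R φ => AlmostSubset C {x | ∃ h : ∀ i, ((φ i).toFun x).Dom,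
        Structure.RelMap R fun i => (φ i).val x (h i)} }
  fun_equiv := by
    intro n f φ ψ h
    refine (AlmostSubset.forall_fin h).mono fun x hx => ?_
    choose y hy hy' using hx
    refine ⟨_, ⟨fun i => Part.dom_iff_mem.2 ⟨_, hy i⟩, rfl⟩,
      ⟨fun i => Part.dom_iff_mem.2 ⟨_, hy' i⟩, ?_⟩⟩
    change ((Structure.funMap f _ : A.carrier) : ℕ) = ((Structure.funMap f _ : A.carrier) : ℕ)
    congr 2
    funext i
    apply Subtype.ext
    exact (Part.get_eq_of_mem (hy' i) _).trans (Part.get_eq_of_mem (hy i) _).symm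
  rel_equiv := by
    have key : ∀ {n : ℕ} {R : L.Relations n} (φ ψ : Fin n → Rep A C), φ ≈ ψ →
        AlmostSubset C {x | ∃ h : ∀ i, ((φ i).toFun x).Dom,
          Structure.RelMap R fun i => (φ i).val x (h i)} →
        AlmostSubset C {x | ∃ h : ∀ i, ((ψ i).toFun x).Dom,
          Structure.RelMap R fun i => (ψ i).val x (h i)} := by
      intro n R φ ψ h hR
      refine ((AlmostSubset.forall_fin h).inter hR).mono fun x hx => ?_
      obtain ⟨hx, hd, hr⟩ := hx
      choose y hy hy' using hx
      refine ⟨fun i => Part.dom_iff_mem.2 ⟨_, hy' i⟩, ?_⟩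
      convert hr using 2 with i
      apply Subtype.ext
      exact (Part.get_eq_of_mem (hy' i) _).trans (Part.get_eq_of_mem (hy i) _).symm
    intro n R φ ψ h
    exact propext ⟨key φ ψ h, key ψ φ (Setoid.symm h)⟩

end CohesivePower

/-- The cohesive power `Π_C A` of a computable structure `A` over `C` (where `C` is cohesive). -/
def CohesivePower {L : FirstOrder.Language.{u, v}} [Finite L.Symbols] (A : ComputableStructure L)
    (C : Set ℕ) : Type :=
  Quotient (CohesivePower.setoid A C)

/-- The first-order structure on `Π_C A`: function symbols act on representatives by
`CohesivePower.apply`, and relation symbols hold of representatives if they hold of the values at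
almost all points of `C`. -/
instance {L : FirstOrder.Language.{u, v}} [Finite L.Symbols] (A : ComputableStructure L) (C : Set ℕ) :
    L.Structure (CohesivePower A C) :=
  inferInstanceAs (L.Structure (Quotient (CohesivePower.setoid A C)))

/-! ### Uniform local finiteness -/

/-- `M` is uniformly locally finite if there is `f : ℕ → ℕ` such that every substructure of `M`
generated by at most `n` elements has (finite) cardinality at most `f n`. -/
def IsUniformlyLocallyFinite (L : FirstOrder.Language.{u, v}) (M : Type*) [L.Structure M] : Prop :=
  ∃ f : ℕ → ℕ, ∀ (n : ℕ) (s : Finset M), s.card ≤ n →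
    Set.encard (Substructure.closure L (s : Set M) : Set M) ≤ f n

/-! ### The examples -/

/-- The relation symbols of the language of strict orders: one binary symbol. -/
inductive StrictOrderRel : ℕ → Type
  | lt : StrictOrderRel 2

/-- The language `{<}` of strict orders. -/
def strictOrderLanguage : FirstOrder.Language.{0, 0} := ⟨fun _ => Empty, StrictOrderRel⟩

/-- The structure `(ℚ, <)`. -/
instance ratStructure : strictOrderLanguage.Structure ℚ where
  funMap := fun f => Empty.elim f
  RelMap := fun R a => match R with
    | .lt => a 0 < a 1

/-- A structure in the language of graphs is (a copy of) the Rado graph if it is a countable simple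
graph such that for any two disjoint finite sets `U` and `V` of vertices there is a vertex outside
`U ∪ V` adjacent to every vertex in `U` and to no vertex in `V`. -/
def IsRadoGraph (M : Type*) [FirstOrder.Language.graph.Structure M] : Prop :=
  Countable M ∧ ∃ G : SimpleGraph M,
    (∀ a b : M, Structure.RelMap FirstOrder.Language.adj ![a, b] ↔ G.Adj a b) ∧
    ∀ U V : Finset M, Disjoint U V →
      ∃ z, z ∉ U ∧ z ∉ V ∧ (∀ u ∈ U, G.Adj z u) ∧ ∀ w ∈ V, ¬ G.Adj z w

/-- The function symbols of the language of Boolean algebras. -/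
inductive BooleanAlgebraFunc : ℕ → Type
  | bot : BooleanAlgebraFunc 0
  | top : BooleanAlgebraFunc 0
  | compl : BooleanAlgebraFunc 1
  | inf : BooleanAlgebraFunc 2
  | sup : BooleanAlgebraFunc 2

/-- The language `{0, 1, ¬, ∧, ∨}` of Boolean algebras. -/
def booleanAlgebraLanguage : FirstOrder.Language.{0, 0} := ⟨BooleanAlgebraFunc, fun _ => Empty⟩

/-- A structure in the language of Boolean algebras is (a copy of) the countable atomless Boolean
algebra if it is a countable, nontrivial Boolean algebra without atoms. -/
def IsCountableAtomlessBooleanAlgebra (M : Type*) [booleanAlgebraLanguage.Structure M] : Prop :=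
  Countable M ∧ Nontrivial M ∧ ∃ _ : BooleanAlgebra M,
    (∀ a : Fin 0 → M,
      Structure.funMap (L := booleanAlgebraLanguage) BooleanAlgebraFunc.bot a = ⊥) ∧
    (∀ a : Fin 0 → M,
      Structure.funMap (L := booleanAlgebraLanguage) BooleanAlgebraFunc.top a = ⊤) ∧
    (∀ a : Fin 1 → M,
      Structure.funMap (L := booleanAlgebraLanguage) BooleanAlgebraFunc.compl a = (a 0)ᶜ) ∧
    (∀ a : Fin 2 → M,
      Structure.funMap (L := booleanAlgebraLanguage) BooleanAlgebraFunc.inf a = a 0 ⊓ a 1) ∧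
    (∀ a : Fin 2 → M,
      Structure.funMap (L := booleanAlgebraLanguage) BooleanAlgebraFunc.sup a = a 0 ⊔ a 1) ∧
    ∀ b : M, ¬ IsAtom b

theorem finite_sigma_of_bound {T : ℕ → Type} (N : ℕ) (h : ∀ n, Finite (T n))
    (hN : ∀ n, T n → n < N) : Finite (Σ n, T n) := by
  have : Finite (Σ n : Fin N, T n) := inferInstance
  exact Finite.of_injective
    (fun x : (Σ n, T n) => (⟨⟨x.1, hN x.1 x.2⟩, x.2⟩ : Σ n : Fin N, T n))
    (by rintro ⟨n, x⟩ ⟨m, y⟩ hxy; simpa using hxy)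

instance : Finite strictOrderLanguage.Symbols := by
  have h1 : Finite (Σ n, strictOrderLanguage.Functions n) :=
    finite_sigma_of_bound 0 (fun _ => inferInstanceAs (Finite Empty)) fun _ f => Empty.elim f
  have h2 : Finite (Σ n, strictOrderLanguage.Relations n) :=
    finite_sigma_of_bound 3
      (fun n => have : Subsingleton (StrictOrderRel n) := ⟨by rintro ⟨⟩ ⟨⟩; rfl⟩
        inferInstanceAs (Finite (StrictOrderRel n)))
      (by rintro _ ⟨⟩; omega)
  exact inferInstanceAs (Finite ((Σ n, strictOrderLanguage.Functions n) ⊕ (Σ n, strictOrderLanguage.Relations n)))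

instance : Finite FirstOrder.Language.graph.Symbols := by
  have h1 : Finite (Σ n, FirstOrder.Language.graph.Functions n) :=
    finite_sigma_of_bound 0 (fun _ => inferInstanceAs (Finite Empty)) fun _ f => Empty.elim f
  have h2 : Finite (Σ n, FirstOrder.Language.graph.Relations n) :=
    finite_sigma_of_bound 3 (fun n => inferInstance) (by rintro _ ⟨⟩; omega)
  exact inferInstanceAs (Finite ((Σ n, FirstOrder.Language.graph.Functions n) ⊕ (Σ n, FirstOrder.Language.graph.Relations n)))

instance : Finite booleanAlgebraLanguage.Symbols := by
  have h1 : Finite (Σ n, booleanAlgebraLanguage.Functions n) :=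
    finite_sigma_of_bound 3
      (fun n => by
        change Finite (BooleanAlgebraFunc n)
        refine Finite.of_injective
          (fun f : BooleanAlgebraFunc n => (match f with
            | .bot => 0 | .top => 1 | .compl => 2 | .inf => 3 | .sup => 4 : Fin 5)) ?_
        rintro ⟨⟩ ⟨⟩ h <;> simp_all)
      (by rintro _ ⟨⟩ <;> omega)
  have h2 : Finite (Σ n, booleanAlgebraLanguage.Relations n) :=
    finite_sigma_of_bound 0 (fun _ => inferInstanceAs (Finite Empty)) fun _ f => Empty.elim f
  exact inferInstanceAs (Finite ((Σ n, booleanAlgebraLanguage.Functions n) ⊕ (Σ n, booleanAlgebraLanguage.Relations n)))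

/-! Both `A` and its cohesive power are countable, so a back-and-forth argument suffices. All
partial isomorphisms are treated as embeddings of finite substructures `S` of `A` into the power;
such an `S` is finite as soon as it is finitely generated.

Two transfer principles carry the proof. By `almost_exists_embedding`, if `S` embeds in the power by
`s ↦ [φ s]`, then at almost all `x ∈ C` the map `s ↦ φ s x` embeds `S` in `A`. This amounts to
finitely many atomic conditions; the negative ones need cohesiveness. Conversely, by
`exists_embedding_of_almost`, if at almost all `x ∈ C` some embedding of `S` in `A` takes prescribed
values `φ i x`, then a search uniform in `x` finds one, and the values found represent an embedding
of `S` in the power.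

Forth: given `b` in `A`, the embedding of `S` at `x` extends to an automorphism of `A` by
ultrahomogeneity, hence to the substructure generated by `S` and `b`. Back: given `[ψ]` in the
power, pull `ψ x` back to `A` by that automorphism. Its type over `S` is one of finitely many,
because uniform local finiteness bounds the generated substructures and the language is finite.
Cohesiveness selects one type that serves almost all `x ∈ C`.

In the examples, ultrahomogeneity comes from one-point extensions, and computable presentations come
from numberings with decidable atomic relations. -/

namespace FirstOrder.Language

/-! ### Diagrams of tuples and embeddings -/

section Diagram

variable {L : Language.{u, v}} {M N I : Type*} [L.Structure M] [L.Structure N]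

/-- Two tuples that satisfy the same unnested atomic formulas. -/
structure SameDiagram (L : Language.{u, v}) [L.Structure M] [L.Structure N] (g : I → M)
    (h : I → N) : Prop where
  eq_iff : ∀ i j, g i = g j ↔ h i = h j
  map_fun : ∀ {n} (f : L.Functions n) (v : Fin n → I) (j : I),
    Structure.funMap f (fun k => g (v k)) = g j → Structure.funMap f (fun k => h (v k)) = h j
  map_rel : ∀ {n} (R : L.Relations n) (v : Fin n → I),
    Structure.RelMap R (fun k => g (v k)) ↔ Structure.RelMap R fun k => h (v k)

/-- A tuple enumerating a substructure is mapped by an embedding of that substructure to any tuple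
with the same diagram. -/
theorem SameDiagram.exists_embedding {g : I → M} {h : I → N} (H : SameDiagram L g h)
    (S : L.Substructure M) (hS : ∀ x, x ∈ S ↔ ∃ i, g i = x) :
    ∃ e : S ↪[L] N, ∀ i (hi : g i ∈ S), e ⟨g i, hi⟩ = h i := by
  choose p hp using fun x : S => (hS x).1 x.2
  refine ⟨⟨⟨fun x => h (p x), fun x y hxy => ?_⟩, fun {n} f v => ?_, fun {n} R v => ?_⟩,
    fun i hi => ?_⟩
  · exact Subtype.ext ((hp x).symm.trans (((H.eq_iff _ _).2 hxy).trans (hp y)))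
  · refine (H.map_fun f (fun k => p (v k)) _ ?_).symm
    simp only [hp]
    rfl
  · refine (H.map_rel R fun k => p (v k)).symm.trans ?_
    simp only [hp]
    rfl
  · exact (H.eq_iff _ _).1 (hp ⟨g i, hi⟩)

end Diagram

/-! ### One-point extension criteria -/

section Extension

variable {L : Language.{u, v}} {M N : Type*} [L.Structure M] [L.Structure N]

/-- An extension to any `S'` around `S` and `m` restricts to the substructure generated by `S` and
`m`, so `S'` may be chosen with a convenient description. -/
theorem isExtensionPair_of_exists_mem_dom
    (h : ∀ S : L.Substructure M, S.FG → ∀ (e : S ↪[L] N) (m : M), ∃ (S' : L.Substructure M)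
      (hle : S ≤ S') (e' : S' ↪[L] N), m ∈ S' ∧ ∀ s : S, e' ⟨s, hle s.2⟩ = e s) :
    L.IsExtensionPair M N := by
  rw [isExtensionPair_iff_exists_embedding_closure_singleton_sup]
  intro S hS e m
  obtain ⟨S', hle, e', hm, he'⟩ := h S hS e m
  have hle' : Substructure.closure L {m} ⊔ S ≤ S' :=
    sup_le (by simpa [Substructure.closure_le] using hm) hle
  refine ⟨e'.comp (Substructure.inclusion hle'), Embedding.ext fun s => ?_⟩
  exact (he' s).symm

/-- Partial isomorphisms are read from `N` to `M`. With `N` the computable structure and `M` its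
power, both directions of the back-and-forth concern embeddings into the power. -/
theorem isExtensionPair_of_exists_mem_cod
    (h : ∀ S : L.Substructure N, S.FG → ∀ (e : S ↪[L] M) (m : M), ∃ (S' : L.Substructure N)
      (hle : S ≤ S') (e' : S' ↪[L] M), S'.FG ∧ (∃ s, e' s = m) ∧
        ∀ s : S, e' ⟨s, hle s.2⟩ = e s) :
    L.IsExtensionPair M N := by
  rw [isExtensionPair_iff_cod]
  rintro ⟨f, hf⟩ m
  obtain ⟨S', hle, e', hfg, ⟨s, rfl⟩, he'⟩ := h f.dom hf f.toEmbedding m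
  refine ⟨⟨⟨S', e'.toHom.range, e'.equivRange⟩, hfg⟩, (e'.equivRange s).2, hle,
    Embedding.ext fun s => ?_⟩
  exact he' s

theorem IsUltrahomogeneous.of_equiv (h : L.IsUltrahomogeneous M) (e : M ≃[L] N)
    [Countable M] : L.IsUltrahomogeneous N := by
  have : Countable N := e.symm.injective.countable
  rw [isUltrahomogeneous_iff_IsExtensionPair Structure.cg_of_countable]
  refine isExtensionPair_of_exists_mem_dom fun S hS f m => ?_
  let S' := S.comap e.toHom
  have hS' : S.map e.symm.toHom = S' := by
    ext x
    simp only [Substructure.mem_map, S', Substructure.mem_comap]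
    constructor
    · rintro ⟨y, hy, rfl⟩
      simpa using hy
    · exact fun hx => ⟨e x, hx, by simp⟩
  have hfg : S'.FG := hS' ▸ hS.map _
  let f' : S' ↪[L] M := e.symm.toEmbedding.comp (f.comp
    ⟨⟨fun x => ⟨e x, x.2⟩, fun x y hxy => Subtype.ext (e.injective (congrArg Subtype.val hxy))⟩,
      fun F x => Subtype.ext (e.map_fun' F _), fun R x => e.map_rel' R _⟩)
  obtain ⟨g, hg⟩ := h S' hfg f'
  -- The conjugated embedding extends to an automorphism `g` of `M`; conjugating back gives a map on
  -- all of `N`.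
  refine ⟨⊤, le_top, ((e.comp g).comp e.symm).toEmbedding.comp (Substructure.subtype ⊤), trivial,
    fun s => ?_⟩
  have hs : e.symm s ∈ S' := by
    change e (e.symm (s : N)) ∈ S
    simp
  have := DFunLike.congr_fun hg ⟨e.symm s, hs⟩
  change e.symm (f ⟨e (e.symm s), hs⟩) = g (e.symm s) at this
  change e (g (e.symm s)) = f s
  rw [← this]
  simp

end Extension

section FiniteLanguage

variable {L : Language.{u, v}}

instance finite_functions [Finite L.Symbols] : Finite (Σ n, L.Functions n) :=
  Finite.of_injective (Sum.inl : _ → L.Symbols) Sum.inl_injective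

instance finite_relations [Finite L.Symbols] : Finite (Σ n, L.Relations n) :=
  Finite.of_injective (Sum.inr : _ → L.Symbols) Sum.inr_injective

end FiniteLanguage

end FirstOrder.Language

/-! ### Uniform local finiteness and finitely many types -/

section LocallyFinite

variable {L : FirstOrder.Language.{u, v}} {M : Type*} [L.Structure M]

theorem IsUniformlyLocallyFinite.finite_of_fg (h : IsUniformlyLocallyFinite L M)
    {S : L.Substructure M} (hS : S.FG) : Finite S := by
  obtain ⟨f, hf⟩ := h
  obtain ⟨s, rfl⟩ := hS
  exact Set.finite_of_encard_le_coe (hf s.card s le_rfl)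

theorem isUniformlyLocallyFinite_of_isRelational [L.IsRelational] :
    IsUniformlyLocallyFinite L M := by
  refine ⟨id, fun n s hs => ?_⟩
  rw [Substructure.closure_eq_of_isRelational, Set.encard_coe_eq_coe_finsetCard]
  exact_mod_cast hs

/-- Repeating one element pads the list to length `K`, so that all sets of at most `K` elements
share one index type. -/
theorem Set.exists_fin_range_eq {α : Type*} {s : Set α} (hne : s.Nonempty) {K : ℕ}
    (hs : s.encard ≤ K) : ∃ g : Fin K → α, Set.range g = s := by
  have hfin : s.Finite := Set.finite_of_encard_le_coe hs
  have hcard : s.ncard ≤ K := by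
    rw [← hfin.cast_ncard_eq] at hs
    exact_mod_cast hs
  obtain ⟨a, ha⟩ := hne
  have : Finite s := hfin
  let e : s ≃ Fin s.ncard := Finite.equivFin s
  refine ⟨fun i => if h : (i : ℕ) < s.ncard then (e.symm ⟨i, h⟩ : α) else a, ?_⟩
  ext x
  constructor
  · rintro ⟨i, rfl⟩
    dsimp only
    split_ifs
    · exact Subtype.prop _
    · exact ha
  · intro hx
    refine ⟨⟨e ⟨x, hx⟩, (e ⟨x, hx⟩).2.trans_le hcard⟩, ?_⟩
    simp

/-- Over a finitely generated substructure of a uniformly locally finite structure for a finite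
language, there are only finitely many quantifier-free `1`-types. -/
theorem IsUniformlyLocallyFinite.exists_finite_types [Finite L.Symbols]
    (h : IsUniformlyLocallyFinite L M) {S : L.Substructure M} (hS : S.FG) :
    ∃ B : Set M, B.Finite ∧ ∀ b, ∃ b' ∈ B,
      ∃ e : (Substructure.closure L {b'} ⊔ S : L.Substructure M) ↪[L] M,
        (∀ hb, e ⟨b', hb⟩ = b) ∧ ∀ s hs, s ∈ S → e ⟨s, hs⟩ = s := by
  have : Finite S := h.finite_of_fg hS
  obtain ⟨f, hf⟩ := h
  obtain ⟨s, hs⟩ := hS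
  classical
  -- `S` and `b` are generated by `s.card + 1` elements, so this bound does not depend on `b`.
  set K := f (s.card + 1)
  have hT : ∀ b, ∃ g : Fin K → M,
      Set.range g = (Substructure.closure L {b} ⊔ S : L.Substructure M) := by
    intro b
    refine Set.exists_fin_range_eq
      ⟨b, (le_sup_left : Substructure.closure L {b} ≤ _) (Substructure.subset_closure rfl)⟩ ?_
    have h1 := hf (s.card + 1) (insert b s) (Finset.card_insert_le b s)
    rwa [Finset.coe_insert, Set.insert_eq, Substructure.closure_union, hs] at h1
  choose g hg using hT
  -- The diagram of the list `g b`: its equalities, function graphs and relations, and the positions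
  -- of the elements of `S` and of `b`. The codomain is finite because the language and `S` are, so
  -- one `b` for each value of `d` yields `B`.
  let d : M → Set (Fin K × Fin K) ×
      Set ((Σ F : (Σ n, L.Functions n), (Fin F.1 → Fin K)) × Fin K) ×
      Set (Σ R : (Σ n, L.Relations n), (Fin R.1 → Fin K)) × Set (S × Fin K) × Set (Fin K) :=
    fun b => ({p | g b p.1 = g b p.2},
      {p | Structure.funMap p.1.1.2 (fun k => g b (p.1.2 k)) = g b p.2},
      {p | Structure.RelMap p.1.2 fun k => g b (p.2 k)}, {p | g b p.2 = p.1}, {i | g b i = b})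
  have hd : ∀ y : Set.range d, ∃ b, d b = y := fun y => y.2
  choose c hc using hd
  refine ⟨Set.range c, Set.finite_range c, fun b => ⟨c ⟨d b, b, rfl⟩, ⟨_, rfl⟩, ?_⟩⟩
  have hb' := hc ⟨d b, b, rfl⟩
  generalize c ⟨d b, b, rfl⟩ = b' at hb'
  simp only [d, Prod.mk.injEq, Set.ext_iff, Set.mem_ofPred_eq, Prod.forall] at hb'
  obtain ⟨h1, h2, h3, h4, h5⟩ := hb'
  have H : SameDiagram L (g b') (g b) :=
    ⟨h1, fun F v j => (h2 ⟨⟨_, F⟩, v⟩ j).1, fun R v => h3 ⟨⟨_, R⟩, v⟩⟩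
  obtain ⟨e, he⟩ := H.exists_embedding (Substructure.closure L {b'} ⊔ S) (fun x => by
    rw [← SetLike.mem_coe, ← hg]; rfl)
  refine ⟨e, fun hb => ?_, fun t ht htS => ?_⟩
  · obtain ⟨i, hi⟩ : b' ∈ Set.range (g b') := by rwa [hg]
    have h6 := he i (by rwa [hi])
    rw [(h5 i).1 hi] at h6
    rw [← h6]
    congr 2
    exact hi.symm
  · obtain ⟨i, hi⟩ : t ∈ Set.range (g b') := by rwa [hg]
    have h6 := he i (by rwa [hi])
    rw [(h4 ⟨t, htS⟩ i).1 hi] at h6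
    refine Eq.trans ?_ h6
    congr 2
    exact hi.symm

end LocallyFinite

/-! ### Decidable predicates and unbounded search -/

section Computability

variable {α β σ : Type*} [Primcodable α] [Primcodable β] [Primcodable σ]

theorem ComputablePred.comp {p : β → Prop} (hp : ComputablePred p) {f : α → β}
    (hf : Computable f) : ComputablePred fun a => p (f a) := by
  classical exact (hp.decide.comp hf).computablePred

theorem ComputablePred.and {p q : α → Prop} (hp : ComputablePred p) (hq : ComputablePred q) :
    ComputablePred fun a => p a ∧ q a := by
  classical
  refine Computable.computablePred
    ((Primrec.and.to_comp.comp hp.decide hq.decide).of_eq fun a => ?_)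
  simp

theorem ComputablePred.const (p : Prop) : ComputablePred fun _ : α => p := by
  classical exact (Computable.const (decide p)).computablePred

theorem ComputablePred.iff_const {p : α → Prop} (hp : ComputablePred p) (q : Prop) :
    ComputablePred fun a => p a ↔ q := by
  by_cases hq : q
  · simpa [hq] using hp
  · simpa [hq] using hp.not

theorem ComputablePred.eq {f g : α → σ} (hf : Computable f) (hg : Computable g) :
    ComputablePred fun a => f a = g a :=
  (PrimrecPred.computablePred Primrec.eq).comp (hf.pair hg)

theorem ComputablePred.forall_finite {ι : Type*} [Finite ι] {p : ι → α → Prop}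
    (hp : ∀ i, ComputablePred (p i)) : ComputablePred fun a => ∀ i, p i a := by
  classical
  have := Fintype.ofFinite ι
  suffices h : ∀ s : Finset ι, ComputablePred fun a => ∀ i ∈ s, p i a by simpa using h Finset.univ
  intro s
  induction s using Finset.induction_on with
  | empty => simpa using ComputablePred.const True
  | insert i s _ ih => simpa using (hp i).and ih

theorem Computable.pi_fin {n : ℕ} {f : Fin n → α → σ} (hf : ∀ i, Computable (f i)) :
    Computable fun a i => f i a :=
  (Primrec.vector_get'.to_comp.comp (Computable.vector_ofFn hf)).of_eq fun a => by
    funext i; simp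

theorem Computable.fin_apply {n : ℕ} (i : Fin n) : Computable fun v : Fin n → σ => v i :=
  Computable.fin_app.comp Computable.id (Computable.const i)

theorem Partrec.exists_search {p : α × β → Prop} (hp : ComputablePred p) :
    ∃ F : α →. β, Partrec F ∧ (∀ a, (F a).Dom ↔ ∃ b, p (a, b)) ∧ ∀ a, ∀ b ∈ F a, p (a, b) := by
  classical
  let s : α → ℕ → Option β := fun a n =>
    (Encodable.decode n : Option β).bind fun b => bif decide (p (a, b)) then some b else Option.none
  have hs : Computable₂ s := by
    refine Computable.option_bind (Computable.decode.comp Computable.snd) ?_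
    refine Computable.cond (hp.decide.comp ?_) (Computable.option_some.comp Computable.snd)
      (Computable.const Option.none)
    exact (Computable.fst.comp Computable.fst).pair Computable.snd
  have hmem : ∀ a n b, b ∈ s a n → p (a, b) := by
    intro a n b hb
    simp only [s, Option.mem_def, Option.bind_eq_some_iff] at hb
    obtain ⟨b', _, hb'⟩ := hb
    by_cases h : p (a, b') <;> simp [h] at hb'
    exact hb' ▸ h
  refine ⟨fun a => Nat.rfindOpt (s a), Partrec.rfindOpt hs, fun a => ?_, fun a b hb => ?_⟩
  · rw [Nat.rfindOpt_dom]
    constructor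
    · rintro ⟨n, b, hb⟩
      exact ⟨b, hmem a n b hb⟩
    · rintro ⟨b, hb⟩
      exact ⟨Encodable.encode b, b, by simp [s, hb]⟩
  · obtain ⟨n, hn⟩ := Nat.rfindOpt_spec hb
    exact hmem a n b hn

theorem Partrec.pi_fin {n : ℕ} {f : Fin n → α →. ℕ} (hf : ∀ i, Partrec (f i)) :
    ∃ F : α →. (Fin n → ℕ), Partrec F ∧ ∀ a v, v ∈ F a ↔ ∀ i, v i ∈ f i a := by
  refine ⟨fun a => (List.Vector.mOfFn fun i => f i a).map List.Vector.get,
    (Partrec.vector_mOfFn hf).map (Primrec.vector_get'.to_comp.comp Computable.snd).to₂,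
    fun a v => ?_⟩
  rw [Part.mem_map_iff]
  constructor
  · rintro ⟨w, hw, rfl⟩
    exact (CohesivePower.mem_mOfFn _ w).1 hw
  · intro h
    refine ⟨List.Vector.ofFn v, (CohesivePower.mem_mOfFn _ _).2 fun i => ?_, ?_⟩
    · simpa using h i
    · funext i; simp

theorem REPred.exists_mem {f : α →. β} (hf : Partrec f) {p : β → Prop} (hp : REPred p) :
    REPred fun a => ∃ b ∈ f a, p b := by
  have h : Partrec fun a => (f a).bind fun b => Part.assert (p b) fun _ => Part.some () :=
    hf.bind (hp.comp Computable.snd).to₂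
  refine h.dom_re.of_eq fun a => ?_
  simp only [Part.dom_iff_mem, Part.mem_bind_iff, Part.mem_assert_iff, Part.mem_some_iff]
  constructor
  · rintro ⟨_, b, hb, h, _⟩
    exact ⟨b, hb, h⟩
  · rintro ⟨b, hb, h⟩
    exact ⟨(), b, hb, h, trivial⟩

end Computability

/-! ### Computable presentations from numberings -/

section Presentation

variable {L : FirstOrder.Language.{u, v}} [Finite L.Symbols]

/-- A structure with a numbering for which equality, the graphs of the functions and the relations
are decidable has a computable presentation. -/
theorem ComputableStructure.exists_equiv_of_numbering {B : Type*} [L.Structure B] (val : ℕ → B)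
    (hval : Function.Surjective val)
    (heq : ComputablePred fun p : ℕ × ℕ => val p.2 = val p.1)
    (hfun : ∀ {n : ℕ} (f : L.Functions n), ComputablePred fun p : (Fin n → ℕ) × ℕ =>
      val p.2 = Structure.funMap f fun i => val (p.1 i))
    (hrel : ∀ {n : ℕ} (R : L.Relations n), ComputablePred fun a : Fin n → ℕ =>
      Structure.RelMap R fun i => val (a i)) :
    ∃ A : ComputableStructure L, Nonempty (A ≃[L] B) := by
  classical
  -- Each element is represented by its least number. Decidable equality makes this number
  -- computable from any other, so the set of least numbers is a computable domain.
  let code : B → ℕ := fun b => Nat.find (hval b)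
  have hcode : ∀ b, val (code b) = b := fun b => Nat.find_spec (hval b)
  have hcanon : Computable fun n => code (val n) :=
    Computable.find (P := fun n m => val m = val n) heq fun n => hval (val n)
  let e : {n | code (val n) = n} ≃ B :=
    { toFun := fun n => val n
      invFun := fun b => ⟨code b, congrArg code (hcode b)⟩
      left_inv := fun n => Subtype.ext n.2
      right_inv := hcode }
  have hcar : ComputablePred fun n => code (val n) = n := ComputablePred.eq hcanon Computable.id
  refine ⟨⟨{n | code (val n) = n}, ⟨_, (e.symm (val 0)).2⟩, hcar, e.symm.inducedStructure,
    fun {n} f => ?_, fun {n} R => ?_⟩, 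
      ⟨@Language.Equiv.symm L B _ _ e.symm.inducedStructure e.symm.inducedStructureEquiv⟩⟩
  · exact ⟨fun a => code (Structure.funMap f fun i => val (a i)),
      Computable.find (P := fun (a : Fin n → ℕ) m => val m = Structure.funMap f fun i => val (a i))
        (hfun f) fun a => hval _, fun a => rfl⟩
  · refine ((ComputablePred.forall_finite fun i : Fin n =>
      hcar.comp (Computable.fin_apply i)).and (hrel R)).of_eq fun a => ?_
    exact ⟨fun h => ⟨h.1, h.2⟩, fun ⟨h, h'⟩ => ⟨h, h'⟩⟩

end Presentation

/-! ### Consequences of cohesiveness -/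

section Cohesive

variable {C : Set ℕ}

theorem AlmostSubset.nonempty (hC : C.Infinite) {W : Set ℕ} (h : AlmostSubset C W) :
    W.Nonempty := by
  obtain ⟨x, hx, hn⟩ := hC.exists_notMem_finite h
  exact ⟨x, by_contra fun hW => hn ⟨hx, hW⟩⟩

theorem AlmostSubset.forall_finite {ι : Type*} [Finite ι] {W : ι → Set ℕ}
    (h : ∀ i, AlmostSubset C (W i)) : AlmostSubset C {x | ∀ i, x ∈ W i} := by
  refine (Set.finite_iUnion h).subset ?_
  rintro x ⟨hx, hn⟩
  obtain ⟨i, hi⟩ := not_forall.1 hn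
  exact Set.mem_iUnion.2 ⟨i, hx, hi⟩

/-- Otherwise cohesiveness would place almost all of `C` in every complement, hence outside the
cover. -/
theorem IsCohesive.exists_of_finite_cover (hC : IsCohesive C) {ι : Type*} [Finite ι]
    {W : ι → Set ℕ} (hW : ∀ i, REPred fun x => x ∈ W i) (h : AlmostSubset C {x | ∃ i, x ∈ W i}) :
    ∃ i, AlmostSubset C (W i) := by
  by_contra! hn
  have h' := AlmostSubset.forall_finite fun i => (hC.2 _ (hW i)).resolve_left (hn i)
  obtain ⟨x, ⟨i, hi⟩, hx⟩ := (h.inter h').nonempty hC.1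
  exact hx i hi

end Cohesive

/-! ### Transfer of finite embeddings between the structure and its power -/

namespace CohesivePower

variable {L : FirstOrder.Language.{u, v}} [Finite L.Symbols] {A : ComputableStructure L}
  {C : Set ℕ}

/-- The class of a representative in the cohesive power. -/
def mk (φ : Rep A C) : CohesivePower A C := Quotient.mk (setoid A C) φ

theorem exists_mk (p : CohesivePower A C) : ∃ φ : Rep A C, mk φ = p := Quotient.exists_rep p

theorem mk_eq_mk {φ ψ : Rep A C} :
    mk φ = mk ψ ↔ AlmostSubset C {x | ∃ y, y ∈ φ.toFun x ∧ y ∈ ψ.toFun x} :=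
  Quotient.eq (r := setoid A C)

theorem funMap_mk {n : ℕ} (f : L.Functions n) (φ : Fin n → Rep A C) :
    (Structure.funMap f fun i => mk (φ i)) = mk (apply f φ) :=
  funMap_quotient_mk' (setoid A C) f φ

theorem relMap_mk {n : ℕ} (R : L.Relations n) (φ : Fin n → Rep A C) :
    (Structure.RelMap R fun i => mk (φ i)) ↔ AlmostSubset C {x | ∃ h : ∀ i, ((φ i).toFun x).Dom,
      Structure.RelMap R fun i => (φ i).val x (h i)} :=
  relMap_quotient_mk' (setoid A C) R φ

/-- A code of a representative determines the class. -/
instance : Countable (CohesivePower A C) := by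
  have h : ∀ p : CohesivePower A C, ∃ c : Nat.Partrec.Code, ∃ φ : Rep A C, c.eval = φ.toFun ∧
      mk φ = p := by
    intro p
    obtain ⟨φ, hφ⟩ := exists_mk p
    obtain ⟨c, hc⟩ := Nat.Partrec.Code.exists_code.1 (Partrec.nat_iff.1 φ.partrec)
    exact ⟨c, φ, hc, hφ⟩
  choose c φ hc hφ using h
  refine Function.Injective.countable (f := c) fun p q hpq => ?_
  rw [← hφ p, ← hφ q, mk_eq_mk]
  have : (φ p).toFun = (φ q).toFun := by rw [← hc, ← hc, hpq]
  exact (φ p).almost_dom.mono fun x hx => ⟨_, Part.get_mem hx, this ▸ Part.get_mem hx⟩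

theorem rePred_relMap {n : ℕ} (R : L.Relations n) (φ : Fin n → Rep A C) :
    REPred fun x => x ∈ {x | ∃ h : ∀ i, ((φ i).toFun x).Dom,
      Structure.RelMap R fun i => (φ i).val x (h i)} := by
  obtain ⟨F, hF, hmem⟩ := Partrec.pi_fin fun i => (φ i).partrec
  refine (REPred.exists_mem hF (A.computable_rel R).to_re).of_eq fun x => ?_
  constructor
  · rintro ⟨v, hv, hc, hr⟩
    have hv' := (hmem x v).1 hv
    refine ⟨fun i => Part.dom_iff_mem.2 ⟨_, hv' i⟩, ?_⟩
    refine (congrArg (Structure.RelMap R) (funext fun i => ?_)).mpr hr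
    exact Subtype.ext (Part.get_eq_of_mem (hv' i) _)
  · rintro ⟨h, hr⟩
    exact ⟨fun i => ((φ i).toFun x).get (h i), (hmem _ _).2 fun i => Part.get_mem (h i),
      fun i => ((φ i).val x (h i)).2, hr⟩

/-- An embedding of a finite structure into the cohesive power is represented at almost all points
of `C` by an embedding into the structure. -/
theorem almost_exists_embedding (hC : IsCohesive C) {S : Type*} [L.Structure S] [Finite S]
    (e : S ↪[L] CohesivePower A C) (φ : S → Rep A C) (hφ : ∀ s, mk (φ s) = e s) :
    AlmostSubset C {x | ∃ e' : S ↪[L] A, ∀ s, (e' s : ℕ) ∈ (φ s).toFun x} := by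
  have hdom : AlmostSubset C {x | ∀ s, ((φ s).toFun x).Dom} :=
    AlmostSubset.forall_finite fun s => (φ s).almost_dom
  have hinj : AlmostSubset C {x | ∀ p : {p : S × S // p.1 ≠ p.2},
      ¬ ∃ y, y ∈ (φ p.1.1).toFun x ∧ y ∈ (φ p.1.2).toFun x} := by
    refine AlmostSubset.forall_finite fun p => ?_
    -- Distinct classes only say that the representatives do not agree almost everywhere. The
    -- agreement set is c.e., so cohesiveness turns this into disagreement almost everywhere.
    refine (hC.2 {x | ∃ y, y ∈ (φ p.1.1).toFun x ∧ y ∈ (φ p.1.2).toFun x} ?_).resolve_left ?_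
    · obtain ⟨F, hF, hmem⟩ := Partrec.pi_fin (f := ![(φ p.1.1).toFun, (φ p.1.2).toFun])
        (by simp [Fin.forall_fin_two, (φ p.1.1).partrec, (φ p.1.2).partrec])
      refine (REPred.exists_mem hF (p := fun v : Fin 2 → ℕ => v 0 = v 1)
        (ComputablePred.eq (Computable.fin_apply 0) (Computable.fin_apply 1)).to_re).of_eq
        fun x => ?_
      simp only [hmem, Fin.forall_fin_two]
      constructor
      · rintro ⟨v, ⟨h1, h2⟩, h⟩
        exact ⟨v 0, h1, h ▸ h2⟩
      · rintro ⟨y, h1, h2⟩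
        exact ⟨![y, y], ⟨h1, h2⟩, rfl⟩
    · rw [← mk_eq_mk, hφ, hφ]
      exact fun h => p.2 (e.injective h)
  have hfun : AlmostSubset C {x | ∀ p : Σ F : (Σ n, L.Functions n), (Fin F.1 → S),
      ∃ y, y ∈ (φ (Structure.funMap p.1.2 p.2)).toFun x ∧
        y ∈ (apply p.1.2 fun i => φ (p.2 i)).toFun x} := by
    refine AlmostSubset.forall_finite fun p => mk_eq_mk.1 ?_
    rw [← funMap_mk, hφ, e.map_fun]
    simp only [hφ]
    rfl
  have hrel : AlmostSubset C {x | ∀ p : Σ R : (Σ n, L.Relations n), (Fin R.1 → S),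
      ((∃ h : ∀ i, ((φ (p.2 i)).toFun x).Dom,
        Structure.RelMap p.1.2 fun i => (φ (p.2 i)).val x (h i)) ↔
          Structure.RelMap p.1.2 p.2)} := by
    refine AlmostSubset.forall_finite fun p => ?_
    have key := relMap_mk p.1.2 fun i => φ (p.2 i)
    simp only [hφ] at key
    have key' := (e.map_rel p.1.2 p.2).symm.trans key
    -- A relation that holds in the power holds almost everywhere by definition. One that fails
    -- there fails almost everywhere by cohesiveness, since the set where it holds is c.e.
    by_cases hR : Structure.RelMap p.1.2 p.2
    · exact (key'.1 hR).mono fun x hx => ⟨fun _ => hR, fun _ => hx⟩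
    · exact ((hC.2 _ (rePred_relMap p.1.2 fun i => φ (p.2 i))).resolve_left
        fun h => hR (key'.2 h)).mono fun x hx => ⟨fun h => (hx h).elim, fun h => (hR h).elim⟩
  refine (((hdom.inter hinj).inter hfun).inter hrel).mono ?_
  rintro x ⟨⟨⟨h1, h2⟩, h3⟩, h4⟩
  refine ⟨⟨⟨fun s => (φ s).val x (h1 s), fun s t hst => ?_⟩, fun {n} f w => ?_,
    fun {n} R w => ?_⟩, fun s => Part.get_mem (h1 s)⟩
  · by_contra hne
    refine h2 ⟨(s, t), hne⟩ ⟨_, Part.get_mem (h1 s), ?_⟩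
    rw [show ((φ s).toFun x).get (h1 s) = ((φ t).toFun x).get (h1 t) from congrArg Subtype.val hst]
    exact Part.get_mem _
  · obtain ⟨y, hy, h, rfl⟩ := h3 ⟨⟨n, f⟩, w⟩
    exact Subtype.ext (Part.get_eq_of_mem hy _)
  · exact ⟨fun h => (h4 ⟨⟨n, R⟩, w⟩).1 ⟨fun i => h1 _, h⟩,
      fun h => ((h4 ⟨⟨n, R⟩, w⟩).2 h).2⟩

/-- With `S` and the language finite, being an embedding is a finite conjunction of decidable
conditions on the values. -/
theorem computablePred_isEmbedding {S : Type*} [L.Structure S] [Finite S] {m : ℕ}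
    (ε : S → Fin m) : ComputablePred fun w : Fin m → ℕ =>
      ∃ e : S ↪[L] A, ∀ s, (e s : ℕ) = w (ε s) := by
  choose G hG hGf using fun F : (Σ n, L.Functions n) => A.computable_fun F.2
  have hproj : ∀ {n : ℕ} (r : Fin n → S),
      Computable fun (w : Fin m → ℕ) (i : Fin n) => w (ε (r i)) :=
    fun r => Computable.pi_fin fun i => Computable.fin_apply _
  have h1 : ComputablePred fun w : Fin m → ℕ => ∀ s, w (ε s) ∈ A.carrier :=
    ComputablePred.forall_finite fun s => A.computable_carrier.comp (Computable.fin_apply _)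
  have h2 : ComputablePred fun w : Fin m → ℕ => ∀ p : {p : S × S // p.1 ≠ p.2},
      ¬ w (ε p.1.1) = w (ε p.1.2) :=
    ComputablePred.forall_finite fun p =>
      (ComputablePred.eq (Computable.fin_apply _) (Computable.fin_apply _)).not
  have h3 : ComputablePred fun w : Fin m → ℕ => ∀ p : Σ F : (Σ n, L.Functions n), (Fin F.1 → S),
      G p.1 (fun i => w (ε (p.2 i))) = w (ε (Structure.funMap p.1.2 p.2)) :=
    ComputablePred.forall_finite fun p =>
      ComputablePred.eq ((hG p.1).comp (hproj p.2)) (Computable.fin_apply _)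
  have h4 : ComputablePred fun w : Fin m → ℕ => ∀ p : Σ R : (Σ n, L.Relations n), (Fin R.1 → S),
      ((∃ h : ∀ i, w (ε (p.2 i)) ∈ A.carrier,
        Structure.RelMap p.1.2 fun i => (⟨w (ε (p.2 i)), h i⟩ : A.carrier)) ↔
          Structure.RelMap p.1.2 p.2) :=
    ComputablePred.forall_finite fun p =>
      ((A.computable_rel p.1.2).comp (hproj p.2)).iff_const _
  refine (h1.and (h2.and (h3.and h4))).of_eq fun w => ?_
  constructor
  · rintro ⟨h1, h2, h3, h4⟩
    refine ⟨⟨⟨fun s => ⟨w (ε s), h1 s⟩, fun s t hst => ?_⟩, fun {n} f r => Subtype.ext ?_,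
      fun {n} R r => ?_⟩, fun s => rfl⟩
    · exact by_contra fun hne => h2 ⟨(s, t), hne⟩ (congrArg Subtype.val hst)
    · exact (h3 ⟨⟨n, f⟩, r⟩).symm.trans (hGf ⟨n, f⟩ fun i => ⟨w (ε (r i)), h1 _⟩)
    · exact ⟨fun h => (h4 ⟨⟨n, R⟩, r⟩).1 ⟨fun i => h1 _, h⟩,
        fun h => ((h4 ⟨⟨n, R⟩, r⟩).2 h).2⟩
  · rintro ⟨e, he⟩
    simp only [← he]
    refine ⟨fun s => (e s).2, fun p h => p.2 (e.injective (Subtype.ext h)), fun p => ?_,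
      fun p => ⟨fun ⟨_, h⟩ => (e.map_rel p.1.2 p.2).1 h,
        fun h => ⟨fun i => (e (p.2 i)).2, (e.map_rel p.1.2 p.2).2 h⟩⟩⟩
    rw [e.map_fun]
    exact hGf p.1 fun i => e (p.2 i)

/-- For a finite structure `S` and representatives indexed by a finite tuple `J` of `S`, there is a
uniform partial computable search for embeddings of `S` with prescribed values on `J`. -/
theorem exists_embedding_search {S : Type*} [L.Structure S] [Finite S] {ι : Type*} [Finite ι]
    (J : ι → S) (φ : ι → Rep A C) :
    REPred (fun x => ∃ e : S ↪[L] A, ∀ i, (e (J i) : ℕ) ∈ (φ i).toFun x) ∧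
    ∃ F : S → ℕ →. ℕ, (∀ s, Partrec (F s)) ∧
      (∀ x s, (F s x).Dom → ∃ e : S ↪[L] A, (∀ i, (e (J i) : ℕ) ∈ (φ i).toFun x) ∧
        ∀ s, (e s : ℕ) ∈ F s x) ∧
      ∀ x s, (∃ e : S ↪[L] A, ∀ i, (e (J i) : ℕ) ∈ (φ i).toFun x) → (F s x).Dom := by
  let ε := Finite.equivFin S
  let δ := Finite.equivFin ι
  obtain ⟨Φ, hΦ, hmem⟩ := Partrec.pi_fin fun i => (φ (δ.symm i)).partrec
  have hp : ComputablePred fun p : (Fin (Nat.card ι) → ℕ) × (Fin (Nat.card S) → ℕ) =>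
      (∃ e : S ↪[L] A, ∀ s, (e s : ℕ) = p.2 (ε s)) ∧ ∀ i, p.2 (ε (J (δ.symm i))) = p.1 i :=
    ((computablePred_isEmbedding ε).comp Computable.snd).and
      (ComputablePred.forall_finite fun i => ComputablePred.eq
        ((Computable.fin_apply _).comp Computable.snd)
        ((Computable.fin_apply _).comp Computable.fst))
  obtain ⟨Q, hQ, hQdom, hQmem⟩ := Partrec.exists_search hp
  -- Evaluate all the prescribed `φ i x`, then search for a whole tuple of values. Each `F s` is a
  -- coordinate of this one tuple, so the values at `x` all come from the same embedding.
  have hG : Partrec fun x => (Φ x).bind Q := hΦ.bind (hQ.comp Computable.snd).to₂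
  have hGmem : ∀ x, ∀ w ∈ (Φ x).bind Q, ∃ e : S ↪[L] A,
      (∀ i, (e (J i) : ℕ) ∈ (φ i).toFun x) ∧ ∀ s, (e s : ℕ) = w (ε s) := by
    intro x w hw
    obtain ⟨a, ha, hw⟩ := Part.mem_bind_iff.1 hw
    obtain ⟨⟨e, he⟩, hJ⟩ := hQmem a w hw
    refine ⟨e, fun i => ?_, he⟩
    have h := (hmem x a).1 ha (δ i)
    have h' : (e (J (δ.symm (δ i))) : ℕ) = a (δ i) := (he _).trans (hJ (δ i))
    rw [← h'] at h
    simpa using h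
  have hGdom : ∀ x, ((Φ x).bind Q).Dom ↔
      ∃ e : S ↪[L] A, ∀ i, (e (J i) : ℕ) ∈ (φ i).toFun x := by
    intro x
    constructor
    · intro h
      obtain ⟨e, he, _⟩ := hGmem x _ (Part.get_mem h)
      exact ⟨e, he⟩
    · rintro ⟨e, he⟩
      have ha : (fun i => (e (J (δ.symm i)) : ℕ)) ∈ Φ x := (hmem _ _).2 fun i => he _
      obtain ⟨w, hw⟩ := Part.dom_iff_mem.1 ((hQdom fun i => (e (J (δ.symm i)) : ℕ)).2
        ⟨fun j => e (ε.symm j), ⟨e, fun s => by simp⟩, fun i => by simp⟩)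
      exact Part.dom_iff_mem.2 ⟨w, Part.mem_bind_iff.2 ⟨_, ha, hw⟩⟩
  refine ⟨hG.dom_re.of_eq hGdom, fun s x => ((Φ x).bind Q).map fun w => w (ε s), fun s =>
    hG.map ((Computable.fin_apply _).comp Computable.snd).to₂, fun x s h => ?_,
    fun x s h => (hGdom x).2 h⟩
  obtain ⟨e, he, hes⟩ := hGmem x _ (Part.get_mem (show ((Φ x).bind Q).Dom from h))
  exact ⟨e, he, fun s => hes s ▸ Part.mem_map _ (Part.get_mem _)⟩

/-- If at almost all points of `C` a finite structure `S` embeds with prescribed values on a tuple,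
then it embeds into the cohesive power with the prescribed classes on the tuple. -/
theorem exists_embedding_of_almost (hC : C.Infinite) {S : Type*} [L.Structure S] [Finite S]
    {ι : Type*} [Finite ι] (J : ι → S) (φ : ι → Rep A C)
    (h : AlmostSubset C {x | ∃ e : S ↪[L] A, ∀ i, (e (J i) : ℕ) ∈ (φ i).toFun x}) :
    ∃ E : S ↪[L] CohesivePower A C, ∀ i, E (J i) = mk (φ i) := by
  obtain ⟨-, F, hF, hFe, hdom⟩ := exists_embedding_search J φ
  let ψ : S → Rep A C := fun s =>
    { toFun := F s
      partrec := hF s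
      mem_carrier := fun x y hy => by
        obtain ⟨e, _, he⟩ := hFe x s (Part.dom_iff_mem.2 ⟨y, hy⟩)
        rw [← Part.mem_unique (he s) hy]
        exact (e s).2
      almost_dom := h.mono fun x hx => hdom x s hx }
  have hval : ∀ x s (hx : ((ψ s).toFun x).Dom), ∃ e : S ↪[L] A,
      (∀ i, (e (J i) : ℕ) ∈ (φ i).toFun x) ∧ (∀ t, (e t : ℕ) ∈ (ψ t).toFun x) ∧
      ∀ t (ht : ((ψ t).toFun x).Dom), (ψ t).val x ht = e t := by
    intro x s hx
    obtain ⟨e, he, het⟩ := hFe x s hx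
    exact ⟨e, he, het, fun t ht => Subtype.ext (Part.get_eq_of_mem (het t) _)⟩
  have hall : AlmostSubset C {x | ∃ e : S ↪[L] A,
      (∀ i, (e (J i) : ℕ) ∈ (φ i).toFun x) ∧ (∀ t, (e t : ℕ) ∈ (ψ t).toFun x) ∧
      ∀ t (ht : ((ψ t).toFun x).Dom), (ψ t).val x ht = e t} := by
    refine h.mono fun x hx => ?_
    obtain ⟨e, he⟩ := hx
    -- The embedding found by the search is reached through some `F s`. If `S` is empty there is
    -- none, but the conditions on `t` are then vacuous.
    rcases isEmpty_or_nonempty S with hS | ⟨⟨s⟩⟩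
    · exact ⟨e, he, fun t => hS.elim t, fun t => hS.elim t⟩
    · exact hval x s (hdom x s ⟨e, he⟩)
  refine ⟨⟨⟨fun s => mk (ψ s), fun s t hst => ?_⟩, fun {n} f r => ?_, fun {n} R r => ?_⟩,
    fun i => ?_⟩
  · obtain ⟨x, ⟨y, hy, hy'⟩, e, -, he, -⟩ := ((mk_eq_mk.1 hst).inter hall).nonempty hC
    refine e.injective (Subtype.ext ?_)
    rw [Part.mem_unique (he s) hy, Part.mem_unique (he t) hy']
  · refine (mk_eq_mk.2 ?_).trans (funMap_mk f fun i => ψ (r i)).symm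
    refine hall.mono ?_
    rintro x ⟨e, -, he, hv⟩
    refine ⟨_, he _, fun i => Part.dom_iff_mem.2 ⟨_, he _⟩, ?_⟩
    rw [e.map_fun]
    refine congrArg (fun v : Fin n → A => ((Structure.funMap f v : A) : ℕ)) (funext fun i => ?_)
    exact hv _ _
  · refine (relMap_mk R fun i => ψ (r i)).trans ⟨fun hR => ?_, fun hR => hall.mono ?_⟩
    · obtain ⟨x, ⟨hd, hr⟩, e, -, he, hv⟩ := (hR.inter hall).nonempty hC
      simp only [hv] at hr
      exact (e.map_rel R r).1 hr
    · rintro x ⟨e, -, he, hv⟩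
      refine ⟨fun i => Part.dom_iff_mem.2 ⟨_, he _⟩, ?_⟩
      simp only [hv]
      exact (e.map_rel R r).2 hR
  · exact mk_eq_mk.2 (hall.mono fun x ⟨e, he, het, _⟩ => ⟨_, het _, he _⟩)

end CohesivePower

/-! ### Back-and-forth between the structure and its power -/

namespace CohesivePower

variable {L : FirstOrder.Language.{u, v}} [Finite L.Symbols] {A : ComputableStructure L}
  {C : Set ℕ}

/-- The representative given by a constant function. -/
def constRep (C : Set ℕ) (a : A) : Rep A C where
  toFun := fun _ => Part.some a
  partrec := (Computable.const (a : ℕ)).partrec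
  mem_carrier := fun _ y hy => by
    rw [Part.mem_some_iff.1 hy]
    exact a.2
  almost_dom := by simp [AlmostSubset]

/-- The inclusion of `S` works at every point. For `S = ⊥`, which may be nonempty because of
constants, this starts the back-and-forth. -/
theorem exists_diagonal_embedding (hC : C.Infinite) (S : L.Substructure A) [Finite S] :
    Nonempty (S ↪[L] CohesivePower A C) := by
  obtain ⟨E, -⟩ := exists_embedding_of_almost hC (fun s : S => s) (fun s : S => constRep C (s : A))
    (Set.finite_empty.subset fun x hx => hx.2 ⟨S.subtype, fun s => Part.mem_some _⟩)
  exact ⟨E⟩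

/-- At almost every `x ∈ C` an automorphism of `A` extends the embedding of `S` at `x`. It need not
be computable: only the existence of an embedding of the larger finite substructure matters, and the
search then finds one. -/
theorem isExtensionPair_structure_power (hA : IsUniformlyLocallyFinite L A)
    (hu : L.IsUltrahomogeneous A) (hC : IsCohesive C) :
    L.IsExtensionPair A (CohesivePower A C) := by
  refine isExtensionPair_of_exists_mem_dom fun S hS e b => ?_
  have : Finite S := hA.finite_of_fg hS
  choose φ hφ using fun s => exists_mk (e s)
  have hS' : (Substructure.closure L {b} ⊔ S).FG := (Substructure.fg_closure_singleton b).sup hS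
  have : Finite (Substructure.closure L {b} ⊔ S : L.Substructure A) := hA.finite_of_fg hS'
  have hle : S ≤ Substructure.closure L {b} ⊔ S := le_sup_right
  have hW : AlmostSubset C {x | ∃ e' : (Substructure.closure L {b} ⊔ S : L.Substructure A) ↪[L] A,
      ∀ s, (e' (Substructure.inclusion hle s) : ℕ) ∈ (φ s).toFun x} := by
    refine (almost_exists_embedding hC e φ hφ).mono ?_
    rintro x ⟨e', he'⟩
    obtain ⟨g, hg⟩ := hu S hS e'
    refine ⟨g.toEmbedding.comp (Substructure.subtype _), fun s => ?_⟩
    have := he' s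
    rw [hg] at this
    exact this
  obtain ⟨E, hE⟩ := exists_embedding_of_almost hC.1 (Substructure.inclusion hle) φ hW
  exact ⟨_, hle, E, (le_sup_left : Substructure.closure L {b} ≤ _)
    (Substructure.subset_closure rfl), fun s => (hE s).trans (hφ s)⟩

/-- The preimage of `p` has to be one element `b`, whereas the automorphism, and with it the pulled
back value of `ψ x`, changes with `x`. The finite set `B` of type representatives gives a finite
c.e. cover of almost all of `C`, to which cohesiveness applies. -/
theorem isExtensionPair_power_structure (hA : IsUniformlyLocallyFinite L A)
    (hu : L.IsUltrahomogeneous A) (hC : IsCohesive C) :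
    L.IsExtensionPair (CohesivePower A C) A := by
  refine isExtensionPair_of_exists_mem_cod fun S hS e p => ?_
  have : Finite S := hA.finite_of_fg hS
  choose φ hφ using fun s => exists_mk (e s)
  obtain ⟨ψ, hψ⟩ := exists_mk p
  obtain ⟨B, hB, htypes⟩ := hA.exists_finite_types hS
  have : Finite B := hB
  let T : A → L.Substructure A := fun b => Substructure.closure L {b} ⊔ S
  have hT : ∀ b, (T b).FG := fun b => (Substructure.fg_closure_singleton b).sup hS
  have hTfin : ∀ b, Finite (T b) := fun b => hA.finite_of_fg (hT b)
  have hle : ∀ b, S ≤ T b := fun b => le_sup_right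
  have hmem : ∀ b, b ∈ T b := fun b => (le_sup_left : Substructure.closure L {b} ≤ T b)
    (Substructure.subset_closure rfl)
  let J : ∀ b, Option S → T b := fun b o => o.elim ⟨b, hmem b⟩ (Substructure.inclusion (hle b))
  let Φ : Option S → Rep A C := fun o => o.elim ψ φ
  obtain ⟨⟨b, hb⟩, hW⟩ := hC.exists_of_finite_cover (ι := B)
    (W := fun b => {x | ∃ e : T b ↪[L] A, ∀ o, (e (J b o) : ℕ) ∈ (Φ o).toFun x})
    (fun b => (exists_embedding_search (J b) Φ).1)
    (((almost_exists_embedding hC e φ hφ).inter ψ.almost_dom).mono (by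
      rintro x ⟨⟨e', he'⟩, hx⟩
      obtain ⟨g, hg⟩ := hu S hS e'
      -- `t` fixes `S` and sends `b'` to the pulled back value, so `g ∘ t` sends `b'` to `ψ x` and
      -- each `s` to `φ s x`.
      obtain ⟨b', hb', t, ht, hts⟩ := htypes (g.symm (ψ.val x hx))
      refine ⟨⟨b', hb'⟩, g.toEmbedding.comp t, ?_⟩
      rintro (_ | s)
      · change ((g (t ⟨b', _⟩) : A) : ℕ) ∈ ψ.toFun x
        rw [ht, g.apply_symm_apply]
        exact Part.get_mem hx
      · change ((g (t ⟨s, _⟩) : A) : ℕ) ∈ (φ s).toFun x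
        have h := he' s
        rw [hg] at h
        have h' : t ⟨s, hle b' s.2⟩ = (s : A) := hts _ _ s.2
        exact (congrArg (fun a : A => ((g a : A) : ℕ) ∈ (φ s).toFun x) h').mpr h))
  obtain ⟨E, hE⟩ := exists_embedding_of_almost hC.1 (J b) Φ hW
  exact ⟨T b, hle b, E, hT b, ⟨J b none, (hE none).trans hψ⟩,
    fun s => (hE (some s)).trans (hφ s)⟩

theorem nonempty_equiv (hA : IsUniformlyLocallyFinite L A)
    (hu : L.IsUltrahomogeneous A) (hC : IsCohesive C) : Nonempty (A ≃[L] CohesivePower A C) := by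
  have : Finite (⊥ : L.Substructure A) := hA.finite_of_fg Substructure.fg_bot
  obtain ⟨e⟩ := exists_diagonal_embedding hC.1 (⊥ : L.Substructure A)
  obtain ⟨f, -⟩ := equiv_between_cg Structure.cg_of_countable Structure.cg_of_countable
    ⟨⟨⊥, e.toHom.range, e.equivRange⟩, Substructure.fg_bot⟩
    (isExtensionPair_structure_power hA hu hC) (isExtensionPair_power_structure hA hu hC)
  exact ⟨f⟩

end CohesivePower

namespace FirstOrder.Language

variable {L : Language.{u, v}} {M : Type*} [L.Structure M]

/-- A one-point extension criterion for ultrahomogeneity in relational languages. -/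
theorem isUltrahomogeneous_of_isRelational [L.IsRelational] [Countable M]
    (h : ∀ (S : L.Substructure M), Finite S → ∀ (e : S ↪[L] M), ∀ m ∉ S, ∃ n,
      SameDiagram L (fun o : Option S => o.elim m Subtype.val) fun o => o.elim n e) :
    L.IsUltrahomogeneous M := by
  rw [isUltrahomogeneous_iff_IsExtensionPair Structure.cg_of_countable]
  refine isExtensionPair_of_exists_mem_dom fun S hS e m => ?_
  by_cases hm : m ∈ S
  · exact ⟨S, le_rfl, e, hm, fun s => rfl⟩
  obtain ⟨n, hn⟩ := h S hS.finite e m hm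
  have hS' : ∀ x, x ∈ Substructure.closure L (insert m (S : Set M)) ↔
      ∃ o : Option S, o.elim m Subtype.val = x := by
    intro x
    rw [Substructure.mem_closure_iff_of_isRelational, Set.mem_insert_iff, Option.exists]
    simp [eq_comm]
  obtain ⟨E, hE⟩ := hn.exists_embedding _ hS'
  exact ⟨_, fun s hs => (hS' s).2 ⟨some ⟨s, hs⟩, rfl⟩, E, (hS' m).2 ⟨none, rfl⟩,
    fun s => hE (some s) _⟩

end FirstOrder.Language

/-! ### The rational order -/

section Rat

instance : strictOrderLanguage.IsRelational := fun _ => inferInstanceAs (IsEmpty Empty)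

theorem strictOrderLanguage.isUltrahomogeneous_rat : strictOrderLanguage.IsUltrahomogeneous ℚ := by
  refine isUltrahomogeneous_of_isRelational fun S hS e m hm => ?_
  have he : ∀ s t, e s < e t ↔ s < t := fun s t =>
    e.map_rel (StrictOrderRel.lt : strictOrderLanguage.Relations 2) ![s, t]
  have := Fintype.ofFinite S
  classical
  -- Density and the absence of endpoints place `n` above the images of the elements below `m` and
  -- below the images of those above `m`.
  obtain ⟨n, hn1, hn2⟩ := Order.exists_between_finsets
    (({s : S | (s : ℚ) < m} : Finset S).image e) (({s : S | m < (s : ℚ)} : Finset S).image e)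
    (by
      simp only [Finset.mem_image, Finset.mem_filter, Finset.mem_univ, true_and]
      rintro _ ⟨s, hs, rfl⟩ _ ⟨t, ht, rfl⟩
      exact (he s t).2 (hs.trans ht))
  have hne : ∀ s : S, m ≠ s := fun s h => hm (h ▸ s.2)
  have h1 : ∀ s : S, (s : ℚ) < m → e s < n := fun s hs => hn1 _ (by simp [hs])
  have h2 : ∀ s : S, m < (s : ℚ) → n < e s := fun s hs => hn2 _ (by simp [hs])
  have h3 : ∀ s : S, (s : ℚ) < m ↔ e s < n := fun s => ⟨h1 s, fun h =>
    (lt_or_gt_of_ne (hne s)).resolve_left fun h' => (h2 s h').not_gt h⟩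
  have h4 : ∀ s : S, m < (s : ℚ) ↔ n < e s := fun s => ⟨h2 s, fun h =>
    (lt_or_gt_of_ne (hne s)).resolve_right fun h' => (h1 s h').not_gt h⟩
  have hlt : ∀ o o' : Option S, o.elim m Subtype.val < o'.elim m Subtype.val ↔
      o.elim n e < o'.elim n e := by
    rintro (_ | s) (_ | t)
    · simp
    · exact h4 t
    · exact h3 s
    · exact (he s t).symm
  refine ⟨n, fun o o' => ?_, fun f => Empty.elim f, ?_⟩
  · simp only [le_antisymm_iff, ← not_lt, hlt]
  · rintro _ ⟨⟩ w
    exact hlt _ _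

/-- A numbering of the rational numbers. -/
def ratOfNat (n : ℕ) : ℚ := ((n.unpair.1.unpair.1 : ℚ) - n.unpair.1.unpair.2) / (n.unpair.2 + 1)

theorem ratOfNat_surjective : Function.Surjective ratOfNat := by
  intro q
  -- The numerator is the difference of its positive and negative parts. The denominator is stored
  -- minus one, so that every code has a nonzero denominator.
  refine ⟨Nat.pair (Nat.pair q.num.toNat (-q.num).toNat) (q.den - 1), ?_⟩
  have h1 : ((q.num.toNat : ℚ) - (-q.num).toNat) = q.num := by
    exact_mod_cast Int.toNat_sub_toNat_neg q.num
  have h2 : ((q.den - 1 : ℕ) : ℚ) + 1 = q.den := by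
    exact_mod_cast Nat.sub_add_cancel q.pos
  simp only [ratOfNat, Nat.unpair_pair, h1, h2]
  exact q.num_div_den

/-- Clearing denominators and moving the negative terms across leaves a comparison in `ℕ`, which is
primitive recursive. -/
theorem ratOfNat_lt_iff (m n : ℕ) : ratOfNat m < ratOfNat n ↔
    m.unpair.1.unpair.1 * (n.unpair.2 + 1) + n.unpair.1.unpair.2 * (m.unpair.2 + 1) <
      n.unpair.1.unpair.1 * (m.unpair.2 + 1) + m.unpair.1.unpair.2 * (n.unpair.2 + 1) := by
  rw [ratOfNat, ratOfNat, div_lt_div_iff₀ (by positivity) (by positivity), ← Nat.cast_lt (α := ℚ)]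
  push_cast
  constructor <;> intro h <;> linarith

attribute [irreducible] ratOfNat

theorem computablePred_ratOfNat_lt :
    ComputablePred fun p : ℕ × ℕ => ratOfNat p.1 < ratOfNat p.2 := by
  refine (PrimrecPred.computablePred ?_).of_eq fun p => (ratOfNat_lt_iff p.1 p.2).symm
  have h1 : Primrec fun n : ℕ => n.unpair.1.unpair.1 :=
    Primrec.fst.comp (Primrec.unpair.comp (Primrec.fst.comp Primrec.unpair))
  have h2 : Primrec fun n : ℕ => n.unpair.1.unpair.2 :=
    Primrec.snd.comp (Primrec.unpair.comp (Primrec.fst.comp Primrec.unpair))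
  have h3 : Primrec fun n : ℕ => n.unpair.2 + 1 :=
    Primrec.succ.comp (Primrec.snd.comp Primrec.unpair)
  exact Primrec.nat_lt.comp
    (Primrec.nat_add.comp (Primrec.nat_mul.comp (h1.comp .fst) (h3.comp .snd))
      (Primrec.nat_mul.comp (h2.comp .snd) (h3.comp .fst)))
    (Primrec.nat_add.comp (Primrec.nat_mul.comp (h1.comp .snd) (h3.comp .fst))
      (Primrec.nat_mul.comp (h2.comp .fst) (h3.comp .snd)))

theorem strictOrderLanguage.exists_computable_presentation_rat :
    ∃ A : ComputableStructure strictOrderLanguage, Nonempty (A ≃[strictOrderLanguage] ℚ) := by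
  refine ComputableStructure.exists_equiv_of_numbering ratOfNat ratOfNat_surjective ?_
    (fun f => Empty.elim f) ?_
  · refine (computablePred_ratOfNat_lt.not.and
      (computablePred_ratOfNat_lt.comp (Computable.snd.pair Computable.fst)).not).of_eq fun p => ?_
    rw [not_lt, not_lt, ← le_antisymm_iff]
  · rintro _ ⟨⟩
    exact ComputablePred.comp (f := fun a : Fin 2 → ℕ => (a 0, a 1)) computablePred_ratOfNat_lt
      ((Computable.fin_apply (0 : Fin 2)).pair (Computable.fin_apply (1 : Fin 2)))

end Rat

/-! ### Binary digits as codes of finite sets -/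

section BinaryDigits

theorem Nat.testBit_sum_two_pow (s : Finset ℕ) (i : ℕ) :
    (∑ j ∈ s, 2 ^ j).testBit i = true ↔ i ∈ s := by
  rw [← Nat.mem_bitIndices, ← List.mem_toFinset, Finset.toFinset_bitIndices_sum_two_pow]

theorem Primrec.testBit : Primrec₂ Nat.testBit := by
  have hpow : Primrec fun i : ℕ => 2 ^ i :=
    (Primrec.nat_rec₁ 1 (Primrec.nat_mul.comp Primrec.snd (Primrec.const 2)).to₂).of_eq fun i => by
      induction i with
      | zero => rfl
      | succ i ih => exact (congrArg (· * 2) ih).trans (pow_succ 2 i).symm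
  have h : PrimrecPred fun p : ℕ × ℕ => p.1 / 2 ^ p.2 % 2 = 1 :=
    Primrec.eq.comp (Primrec.nat_mod.comp (Primrec.nat_div.comp Primrec.fst (hpow.comp Primrec.snd))
      (Primrec.const 2)) (Primrec.const 1)
  exact h.decide.of_eq fun p => (Nat.testBit_eq_decide_div_mod_eq).symm

end BinaryDigits

/-! ### The Rado graph -/

section Rado

variable {M N : Type*} [Language.graph.Structure M] [Language.graph.Structure N]

theorem FirstOrder.Language.graph.relMap_iff {V : Type*} [Language.graph.Structure V]
    (a : Fin 2 → V) : Structure.RelMap adj a ↔ Structure.RelMap adj ![a 0, a 1] := by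
  rw [show ![a 0, a 1] = a from by funext i; fin_cases i <;> rfl]

theorem IsRadoGraph.of_equiv (h : IsRadoGraph M) (e : N ≃[Language.graph] M) : IsRadoGraph N := by
  obtain ⟨hc, G, hG, hext⟩ := h
  refine ⟨e.injective.countable, G.comap e, fun a b => ?_, fun U V hUV => ?_⟩
  · rw [SimpleGraph.comap_adj, ← hG, ← e.map_rel, graph.relMap_iff]
    rfl
  · have hdisj : Disjoint (U.map e.toEquiv.toEmbedding) (V.map e.toEquiv.toEmbedding) :=
      (Finset.disjoint_map _).2 hUV
    obtain ⟨z, hU, hV, hzU, hzV⟩ := hext _ _ hdisj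
    have key : ∀ (W : Finset N) (x : N), x ∈ W → e x ∈ W.map e.toEquiv.toEmbedding :=
      fun W x hx => Finset.mem_map_of_mem _ hx
    refine ⟨e.symm z, fun hz => hU ?_, fun hz => hV ?_, fun u hu => ?_, fun w hw => ?_⟩
    · simpa using key U _ hz
    · simpa using key V _ hz
    · simpa using hzU _ (key U u hu)
    · simpa using hzV _ (key V w hw)

theorem IsRadoGraph.infinite (h : IsRadoGraph M) : Infinite M := by
  obtain ⟨-, G, -, hext⟩ := h
  refine ⟨fun hfin => ?_⟩
  have := Fintype.ofFinite M
  obtain ⟨z, hz, -⟩ := hext Finset.univ ∅ (Finset.disjoint_empty_right _)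
  exact hz (Finset.mem_univ z)

theorem IsRadoGraph.isUltrahomogeneous (h : IsRadoGraph M) :
    Language.graph.IsUltrahomogeneous M := by
  obtain ⟨hc, G, hG, hext⟩ := h
  refine isUltrahomogeneous_of_isRelational fun S hS e m hm => ?_
  have hG' : ∀ a : Fin 2 → M, Structure.RelMap adj a ↔ G.Adj (a 0) (a 1) := fun a =>
    (graph.relMap_iff a).trans (hG _ _)
  have he : ∀ s t, G.Adj (e s) (e t) ↔ G.Adj (s : M) t := fun s t =>
    (hG' _).symm.trans ((e.map_rel adj ![s, t]).trans (hG' (fun i => (![s, t] i : M))))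
  classical
  have := Fintype.ofFinite S
  -- `U` and `V` are the images of the neighbours and of the non-neighbours of `m`. Since `z` avoids
  -- both, it differs from every `e s`.
  obtain ⟨z, hU, hV, hzU, hzV⟩ := hext
    (({s : S | G.Adj m s} : Finset S).image e) (({s : S | ¬ G.Adj m s} : Finset S).image e)
    ((Finset.disjoint_image e.injective).2 (Finset.disjoint_filter_filter_not _ _ _))
  simp only [Finset.mem_image, Finset.mem_filter, Finset.mem_univ, true_and, not_exists, not_and,
    forall_exists_index, and_imp, forall_apply_eq_imp_iff₂] at hU hV hzU hzV
  have hadj : ∀ s : S, G.Adj m s ↔ G.Adj z (e s) := fun s =>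
    ⟨hzU s, fun h => by_contra fun hn => hzV s hn h⟩
  have hz : ∀ s : S, e s ≠ z := fun s => (em (G.Adj m s)).elim (hU s) (hV s)
  have hms : ∀ s : S, m ≠ s := fun s h => hm (h ▸ s.2)
  refine ⟨z, ?_, fun f => Empty.elim f, ?_⟩
  · rintro (_ | s) (_ | t)
    · simp
    · exact iff_of_false (hms t) fun h => hz t h.symm
    · exact iff_of_false (fun h => hms s h.symm) (hz s)
    · exact Subtype.ext_iff.symm.trans e.injective.eq_iff.symm
  · have hall : ∀ o o' : Option S, G.Adj (o.elim m Subtype.val) (o'.elim m Subtype.val) ↔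
        G.Adj (o.elim z e) (o'.elim z e) := by
      rintro (_ | s) (_ | t)
      · simp
      · exact hadj t
      · exact (G.adj_comm _ _).trans ((hadj s).trans (G.adj_comm _ _))
      · exact (he s t).symm
    rintro _ ⟨⟩ w
    exact (hG' _).trans ((hall _ _).trans (hG' fun k => (w k).elim z e).symm)

/-- The graph on the natural numbers in which `a` and `b` are adjacent if the `a`-th binary digit
of `b` or the `b`-th binary digit of `a` is `1`. -/
def binaryDigitGraph : SimpleGraph ℕ where
  Adj a b := a.testBit b = true ∨ b.testBit a = true
  symm := ⟨fun _ _ h => h.symm⟩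
  loopless := ⟨fun a h => by
    simp [Nat.testBit_eq_false_of_lt (Nat.lt_two_pow_self (n := a))] at h⟩

theorem binaryDigitGraph_extension (U V : Finset ℕ) (hUV : Disjoint U V) :
    ∃ z, z ∉ U ∧ z ∉ V ∧ (∀ u ∈ U, binaryDigitGraph.Adj z u) ∧
      ∀ w ∈ V, ¬ binaryDigitGraph.Adj z w := by
  classical
  obtain ⟨N, hN⟩ := (U ∪ V).bddAbove
  have hN' : ∀ x ∈ U ∪ V, x < N + 1 := fun x hx => Nat.lt_succ_of_le (hN hx)
  -- The digits at `U` give the required adjacencies. The extra digit lies beyond `U ∪ V` and makes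
  -- `z` exceed all of its elements, so digit `z` of any `w ∈ V` is zero.
  let z := ∑ j ∈ insert (N + 1) U, 2 ^ j
  have hz : ∀ x ∈ U ∪ V, x < z := fun x hx => (hN' x hx).trans (Nat.lt_two_pow_self.trans_le
    (Finset.single_le_sum (f := fun j => 2 ^ j) (fun _ _ => Nat.zero_le _)
      (Finset.mem_insert_self (N + 1) U)))
  refine ⟨z, fun h => (hz z (Finset.mem_union_left _ h)).ne rfl,
    fun h => (hz z (Finset.mem_union_right _ h)).ne rfl,
    fun u hu => Or.inl ((Nat.testBit_sum_two_pow _ _).2 (Finset.mem_insert_of_mem hu)), ?_⟩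
  rintro w hw (h | h)
  · have hw' := Finset.mem_union_right U hw
    rcases Finset.mem_insert.1 ((Nat.testBit_sum_two_pow _ _).1 h) with h | h
    · exact (hN' w hw').ne h
    · exact Finset.disjoint_left.1 hUV h hw
  · rw [Nat.testBit_eq_false_of_lt
      ((hz w (Finset.mem_union_right U hw)).trans Nat.lt_two_pow_self)] at h
    exact Bool.false_ne_true h

theorem IsRadoGraph.exists_computable_presentation :
    ∃ A : ComputableStructure Language.graph, IsRadoGraph A := by
  let := binaryDigitGraph.structure
  have hR : IsRadoGraph ℕ := ⟨inferInstance, binaryDigitGraph, fun a b => Iff.rfl,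
    binaryDigitGraph_extension⟩
  obtain ⟨A, ⟨e⟩⟩ := ComputableStructure.exists_equiv_of_numbering (L := Language.graph)
    (id : ℕ → ℕ) Function.surjective_id (ComputablePred.eq Computable.snd Computable.fst)
    (fun f => Empty.elim f) (by
      rintro _ ⟨⟩
      have h : ∀ i j : Fin 2, ComputablePred fun a : Fin 2 → ℕ => (a i).testBit (a j) = true :=
        fun i j => ComputablePred.eq
          (Primrec.testBit.to_comp.comp (Computable.fin_apply i) (Computable.fin_apply j))
          (Computable.const true)
      refine ((h 0 1).not.and (h 1 0).not).not.of_eq fun a => ?_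
      exact not_and_or.trans (or_congr not_not not_not))
  exact ⟨A, hR.of_equiv e⟩

end Rado

/-! ### Finite extensions of Boolean algebras -/

section BooleanAlgebra

variable {B M N : Type*} [BooleanAlgebra B] [BooleanAlgebra M] [BooleanAlgebra N]

/-- For Boolean homomorphisms out of `B`, the homomorphism on `B × B` that follows the first
coordinate below `m` and the second one below the complement of `m`. -/
def BoundedLatticeHom.glue (f : BoundedLatticeHom B M) (m : M) : BoundedLatticeHom (B × B) M where
  toFun p := (m ⊓ f p.1) ⊔ (mᶜ ⊓ f p.2)
  map_sup' p q := by
    simp only [Prod.fst_sup, Prod.snd_sup, map_sup, inf_sup_left]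
    exact sup_sup_sup_comm _ _ _ _
  map_inf' p q := by
    have h1 : (m ⊓ f p.1) ⊓ (mᶜ ⊓ f q.2) = ⊥ := by
      rw [inf_inf_inf_comm, inf_compl_eq_bot, bot_inf_eq]
    have h2 : (mᶜ ⊓ f p.2) ⊓ (m ⊓ f q.1) = ⊥ := by
      rw [inf_inf_inf_comm, inf_comm mᶜ, inf_compl_eq_bot, bot_inf_eq]
    simp only [Prod.fst_inf, Prod.snd_inf, map_inf]
    rw [inf_sup_right, inf_sup_left (m ⊓ f p.1), inf_sup_left (mᶜ ⊓ f p.2), h1, h2, sup_bot_eq,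
      bot_sup_eq, inf_inf_inf_comm m, inf_inf_inf_comm mᶜ, inf_idem, inf_idem]
  map_top' := by simp
  map_bot' := by simp

theorem BoundedLatticeHom.glue_apply (f : BoundedLatticeHom B M) (m : M) (p : B × B) :
    f.glue m p = (m ⊓ f p.1) ⊔ (mᶜ ⊓ f p.2) := rfl

/-- With `glue_top_bot` this shows that the image of `f.glue m` contains `m` and the range of `f`.
That image is what adjoining `m` produces, parametrized by `B × B`. -/
theorem BoundedLatticeHom.glue_diag (f : BoundedLatticeHom B M) (m : M) (x : B) :
    f.glue m (x, x) = f x := by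
  rw [glue_apply, ← inf_sup_right, sup_compl_eq_top, top_inf_eq]

theorem BoundedLatticeHom.glue_top_bot (f : BoundedLatticeHom B M) (m : M) :
    f.glue m (⊤, ⊥) = m := by
  simp [glue_apply]

theorem BoundedLatticeHom.glue_eq_bot_iff (f : BoundedLatticeHom B M) (m : M) (p : B × B) :
    f.glue m p = ⊥ ↔ m ⊓ f p.1 = ⊥ ∧ mᶜ ⊓ f p.2 = ⊥ := by
  rw [glue_apply, sup_eq_bot_iff]

/-- Reduces comparing the equalities under two homomorphisms to comparing which elements they send
to `⊥`. -/
theorem BoundedLatticeHom.eq_iff_symmDiff (f : BoundedLatticeHom B M) (x y : B) :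
    f x = f y ↔ f (symmDiff x y) = ⊥ := by
  rw [map_symmDiff', symmDiff_eq_bot]

/-- In a finite Boolean algebra, a property that is inherited by one of the two parts of every
splitting and fails at `⊥` holds at some atom below each element where it holds. -/
theorem exists_isAtom_of_splitting [Finite B] (Q : B → Prop) (hbot : ¬ Q ⊥)
    (hQ : ∀ x y, Q x → Q (x ⊓ y) ∨ Q (x ⊓ yᶜ)) {x : B} (hx : Q x) :
    ∃ p ≤ x, IsAtom p ∧ Q p := by
  obtain ⟨p, ⟨hpx, hQp⟩, hmin⟩ := WellFounded.has_min (wellFounded_lt (α := B))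
    {p | p ≤ x ∧ Q p} ⟨x, le_rfl, hx⟩
  refine ⟨p, hpx, ⟨fun h => hbot (h ▸ hQp), fun q hq => ?_⟩, hQp⟩
  rcases hQ p q hQp with h | h
  · rw [inf_eq_right.2 hq.le] at h
    exact (hmin q ⟨hq.le.trans hpx, h⟩ hq).elim
  · have hp : p ⊓ qᶜ = p := by
      by_contra hne
      exact hmin _ ⟨inf_le_left.trans hpx, h⟩ (lt_of_le_of_ne inf_le_left hne)
    -- Minimality gives `p ≤ qᶜ`; with `q ≤ p` this forces `q ≤ qᶜ`, hence `q = ⊥`.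
    exact le_compl_self.1 (hq.le.trans (inf_eq_left.1 hp))

/-- Splitting `x` along `y` writes `m ⊓ f x` as a join of two parts, one of which is nonzero if the
join is. Hence atoms decide where `m` meets the range of `f`. -/
theorem BoundedLatticeHom.inf_apply_ne_bot_iff [Finite B] (f : BoundedLatticeHom B M) (m : M)
    (x : B) : m ⊓ f x ≠ ⊥ ↔ ∃ p ≤ x, IsAtom p ∧ m ⊓ f p ≠ ⊥ := by
  constructor
  · refine fun hx => exists_isAtom_of_splitting (fun x => m ⊓ f x ≠ ⊥) (by simp) ?_ hx
    intro x y hxy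
    by_contra! h
    refine hxy ?_
    rw [← sup_inf_inf_compl (x := x) (y := y), map_sup, inf_sup_left, h.1, h.2, sup_bot_eq]
  · rintro ⟨p, hpx, -, hp⟩ h
    exact hp (le_bot_iff.1 (h ▸ inf_le_inf_left m (OrderHomClass.mono f hpx)))

/-- One-point extension of isomorphisms between finite Boolean algebras into an atomless one. -/
theorem exists_inf_eq_bot_iff [Finite B] (hN : ∀ b : N, ¬ IsAtom b) (f : BoundedLatticeHom B M)
    (g : BoundedLatticeHom B N) (hf : Function.Injective f) (hg : Function.Injective g) (m : M) :
    ∃ n : N, ∀ x, (m ⊓ f x = ⊥ ↔ n ⊓ g x = ⊥) ∧ (mᶜ ⊓ f x = ⊥ ↔ nᶜ ⊓ g x = ⊥) := by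
  -- The part `c` of `g p` imitates the part of `f p` inside `m`: empty, everything, or strictly
  -- between. The last case is possible because `g p` is not an atom.
  have hc : ∀ p : B, ∃ c ≤ g p, p ≠ ⊥ → ((m ⊓ f p = ⊥ ↔ c = ⊥) ∧
      (mᶜ ⊓ f p = ⊥ ↔ c = g p)) := by
    intro p
    by_cases hp : p = ⊥
    · exact ⟨⊥, bot_le, fun h => (h hp).elim⟩
    have hfp : f p ≠ ⊥ := fun h => hp (hf (h.trans (map_bot f).symm))
    have hgp : g p ≠ ⊥ := fun h => hp (hg (h.trans (map_bot g).symm))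
    have hsplit : ¬ (m ⊓ f p = ⊥ ∧ mᶜ ⊓ f p = ⊥) := by
      rintro ⟨h1, h2⟩
      have := f.glue_diag m p
      rw [f.glue_apply, h1, h2, bot_sup_eq] at this
      exact hfp this.symm
    by_cases h1 : m ⊓ f p = ⊥
    · exact ⟨⊥, bot_le, fun _ => ⟨by simp [h1], iff_of_false (fun h2 => hsplit ⟨h1, h2⟩) hgp.symm⟩⟩
    by_cases h2 : mᶜ ⊓ f p = ⊥
    · exact ⟨g p, le_rfl, fun _ => ⟨iff_of_false h1 hgp, by simp [h2]⟩⟩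
    have hatom := hN (g p)
    rw [IsAtom] at hatom
    push Not at hatom
    obtain ⟨c, hlt, hne⟩ := hatom hgp
    exact ⟨c, hlt.le, fun _ => ⟨iff_of_false h1 hne, iff_of_false h2 hlt.ne⟩⟩
  choose c hcle hc using hc
  classical
  have := Fintype.ofFinite B
  let n : N := ({p : B | IsAtom p} : Finset B).sup c
  -- Distinct atoms have disjoint images under `g`, so only the summand `c p` of `n` meets `g p`.
  have hn : ∀ p, IsAtom p → n ⊓ g p = c p := by
    intro p hp
    refine le_antisymm ?_ (le_inf (Finset.le_sup (f := c) (by simpa using hp)) (hcle p))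
    rw [Finset.sup_inf_distrib_right]
    refine Finset.sup_le fun q hq => ?_
    by_cases hqp : q = p
    · rw [hqp]
      exact inf_le_left
    · have hdisj : q ⊓ p = ⊥ := (IsAtom.disjoint_of_ne (by simpa using hq) hp hqp).eq_bot
      refine (inf_le_inf_right _ (hcle q)).trans ?_
      rw [← map_inf, hdisj, map_bot]
      exact bot_le
  have hn' : ∀ p, IsAtom p → (nᶜ ⊓ g p = ⊥ ↔ c p = g p) := by
    intro p hp
    rw [← hn p hp, inf_eq_right, inf_comm, ← sdiff_eq, sdiff_eq_bot_iff]
  refine ⟨n, fun x => ⟨not_iff_not.1 ?_, not_iff_not.1 ?_⟩⟩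
  · rw [← ne_eq, ← ne_eq, f.inf_apply_ne_bot_iff, g.inf_apply_ne_bot_iff]
    refine exists_congr fun p => and_congr_right fun _ => and_congr_right fun hp => ?_
    rw [hn p hp]
    exact (hc p hp.1).1.not
  · rw [← ne_eq, ← ne_eq, f.inf_apply_ne_bot_iff, g.inf_apply_ne_bot_iff]
    refine exists_congr fun p => and_congr_right fun _ => and_congr_right fun hp => ?_
    rw [ne_eq, ne_eq, hn' p hp]
    exact (hc p hp.1).2.not

theorem exists_glue_eq_iff [Finite B] (hN : ∀ b : N, ¬ IsAtom b) (f : BoundedLatticeHom B M)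
    (g : BoundedLatticeHom B N) (hf : Function.Injective f) (hg : Function.Injective g) (m : M) :
    ∃ n : N, ∀ p q, f.glue m p = f.glue m q ↔ g.glue n p = g.glue n q := by
  obtain ⟨n, hn⟩ := exists_inf_eq_bot_iff hN f g hf hg m
  refine ⟨n, fun p q => ?_⟩
  rw [BoundedLatticeHom.eq_iff_symmDiff, BoundedLatticeHom.eq_iff_symmDiff,
    BoundedLatticeHom.glue_eq_bot_iff, BoundedLatticeHom.glue_eq_bot_iff, (hn _).1, (hn _).2]

/-- Adjoining one element replaces `T` by an image of `T × T`, so the bound is squared. It starts at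
`2` with `{⊥, ⊤}`. -/
theorem exists_booleanSubalgebra_encard_le (s : Finset M) :
    ∃ T : BooleanSubalgebra M, (s : Set M) ⊆ T ∧ (T : Set M).encard ≤ (2 ^ 2 ^ s.card : ℕ) := by
  classical
  induction s using Finset.induction_on with
  | empty =>
    refine ⟨⊥, by simp, ?_⟩
    rw [BooleanSubalgebra.coe_bot]
    exact (Set.encard_insert_le _ _).trans (by simp; norm_num)
  | insert a s ha ih =>
    obtain ⟨T, hsT, hT⟩ := ih
    refine ⟨(⊤ : BooleanSubalgebra (T × T)).map (T.subtype.glue a), ?_, ?_⟩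
    · rw [Finset.coe_insert, Set.insert_subset_iff]
      refine ⟨⟨(⊤, ⊥), trivial, T.subtype.glue_top_bot a⟩, fun x hx => ?_⟩
      exact ⟨(⟨x, hsT hx⟩, ⟨x, hsT hx⟩), trivial, T.subtype.glue_diag a ⟨x, hsT hx⟩⟩
    · rw [BooleanSubalgebra.coe_map]
      refine (Set.encard_image_le _ _).trans ?_
      rw [BooleanSubalgebra.coe_top, Set.encard_univ, ENat.card_prod, Finset.card_insert_of_notMem ha,
        pow_succ, pow_mul, sq, Nat.cast_mul]
      exact mul_le_mul' hT hT

end BooleanAlgebra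

/-! ### Boolean algebras as first-order structures -/

/-- The function symbols of the language of Boolean algebras are interpreted by the operations of a
Boolean algebra. -/
structure InterpretsBooleanAlgebra (M : Type*) [booleanAlgebraLanguage.Structure M]
    [BooleanAlgebra M] : Prop where
  funMap_bot : ∀ a : Fin 0 → M,
    Structure.funMap (L := booleanAlgebraLanguage) BooleanAlgebraFunc.bot a = ⊥
  funMap_top : ∀ a : Fin 0 → M,
    Structure.funMap (L := booleanAlgebraLanguage) BooleanAlgebraFunc.top a = ⊤
  funMap_compl : ∀ a : Fin 1 → M,
    Structure.funMap (L := booleanAlgebraLanguage) BooleanAlgebraFunc.compl a = (a 0)ᶜ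
  funMap_inf : ∀ a : Fin 2 → M,
    Structure.funMap (L := booleanAlgebraLanguage) BooleanAlgebraFunc.inf a = a 0 ⊓ a 1
  funMap_sup : ∀ a : Fin 2 → M,
    Structure.funMap (L := booleanAlgebraLanguage) BooleanAlgebraFunc.sup a = a 0 ⊔ a 1

namespace InterpretsBooleanAlgebra

variable {M N : Type*} [booleanAlgebraLanguage.Structure M] [BooleanAlgebra M]
  [booleanAlgebraLanguage.Structure N] [BooleanAlgebra N]

/-- A Boolean subalgebra as a substructure. -/
def substructure (H : InterpretsBooleanAlgebra M) (T : BooleanSubalgebra M) :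
    booleanAlgebraLanguage.Substructure M where
  carrier := T
  fun_mem := by
    rintro _ (_ | _ | _ | _ | _) a ha
    · rw [H.funMap_bot]
      exact T.bot_mem
    · rw [H.funMap_top]
      exact T.top_mem
    · rw [H.funMap_compl]
      exact T.compl_mem (ha 0)
    · rw [H.funMap_inf]
      exact T.inf_mem (ha 0) (ha 1)
    · rw [H.funMap_sup]
      exact T.sup_mem (ha 0) (ha 1)

/-- A substructure as a Boolean subalgebra. -/
def booleanSubalgebra (H : InterpretsBooleanAlgebra M)
    (S : booleanAlgebraLanguage.Substructure M) : BooleanSubalgebra M where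
  carrier := S
  supClosed' a ha b hb := by
    rw [show a ⊔ b = _ from (H.funMap_sup ![a, b]).symm]
    exact S.fun_mem _ _ (by simpa [Fin.forall_fin_two] using ⟨ha, hb⟩)
  infClosed' a ha b hb := by
    rw [show a ⊓ b = _ from (H.funMap_inf ![a, b]).symm]
    exact S.fun_mem _ _ (by simpa [Fin.forall_fin_two] using ⟨ha, hb⟩)
  compl_mem' {a} ha := by
    have := H.funMap_compl (fun _ => a)
    change _ = aᶜ at this
    rw [← this]
    exact S.fun_mem _ _ (by simpa using ha)
  bot_mem' := by
    rw [← H.funMap_bot Fin.elim0]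
    exact S.fun_mem _ _ (by simp)

theorem isUniformlyLocallyFinite (H : InterpretsBooleanAlgebra M) :
    IsUniformlyLocallyFinite booleanAlgebraLanguage M := by
  refine ⟨fun n => 2 ^ 2 ^ n, fun n s hs => ?_⟩
  obtain ⟨T, hsT, hT⟩ := exists_booleanSubalgebra_encard_le s
  have hle : Substructure.closure booleanAlgebraLanguage (s : Set M) ≤ H.substructure T :=
    Substructure.closure_le.2 hsT
  refine (Set.encard_le_encard (SetLike.coe_subset_coe.2 hle)).trans (hT.trans ?_)
  exact Nat.cast_le.2 (Nat.pow_le_pow_right two_pos (Nat.pow_le_pow_right two_pos hs))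

/-- An embedding of a substructure as a Boolean homomorphism. -/
def boundedLatticeHom (H : InterpretsBooleanAlgebra M) (H' : InterpretsBooleanAlgebra N)
    {S : booleanAlgebraLanguage.Substructure M} (e : S ↪[booleanAlgebraLanguage] N) :
    BoundedLatticeHom (H.booleanSubalgebra S) N where
  toFun x := e ⟨x, x.2⟩
  map_sup' x y := by
    have h := e.map_fun (BooleanAlgebraFunc.sup : booleanAlgebraLanguage.Functions 2)
      ![⟨x, x.2⟩, ⟨y, y.2⟩]
    rw [H'.funMap_sup] at h
    refine (congrArg e (Subtype.ext ?_)).trans h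
    exact (H.funMap_sup fun k => ((![⟨x, x.2⟩, ⟨y, y.2⟩] : Fin 2 → S) k : M)).symm
  map_inf' x y := by
    have h := e.map_fun (BooleanAlgebraFunc.inf : booleanAlgebraLanguage.Functions 2)
      ![⟨x, x.2⟩, ⟨y, y.2⟩]
    rw [H'.funMap_inf] at h
    refine (congrArg e (Subtype.ext ?_)).trans h
    exact (H.funMap_inf fun k => ((![⟨x, x.2⟩, ⟨y, y.2⟩] : Fin 2 → S) k : M)).symm
  map_top' := by
    have h := e.map_fun (BooleanAlgebraFunc.top : booleanAlgebraLanguage.Functions 0) ![]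
    rw [H'.funMap_top] at h
    exact (congrArg e (Subtype.ext (H.funMap_top _).symm)).trans h
  map_bot' := by
    have h := e.map_fun (BooleanAlgebraFunc.bot : booleanAlgebraLanguage.Functions 0) ![]
    rw [H'.funMap_bot] at h
    exact (congrArg e (Subtype.ext (H.funMap_bot _).symm)).trans h

/-- The operation can be computed in `B`, so the same `b` serves for `f` and `g`. Agreement of
function graphs thus follows from agreement of equalities. -/
theorem exists_funMap_eq {B : Type*} [BooleanAlgebra B] (H : InterpretsBooleanAlgebra M)
    (H' : InterpretsBooleanAlgebra N) (f : BoundedLatticeHom B M) (g : BoundedLatticeHom B N)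
    {n : ℕ} (F : booleanAlgebraLanguage.Functions n) (v : Fin n → B) :
    ∃ b, (Structure.funMap F fun k => f (v k)) = f b ∧
      (Structure.funMap F fun k => g (v k)) = g b := by
  rcases F with _ | _ | _ | _ | _
  · exact ⟨⊥, (H.funMap_bot _).trans (map_bot f).symm, (H'.funMap_bot _).trans (map_bot g).symm⟩
  · exact ⟨⊤, (H.funMap_top _).trans (map_top f).symm, (H'.funMap_top _).trans (map_top g).symm⟩
  · exact ⟨(v 0)ᶜ, (H.funMap_compl _).trans (map_compl' f _).symm,
      (H'.funMap_compl _).trans (map_compl' g _).symm⟩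
  · exact ⟨v 0 ⊓ v 1, (H.funMap_inf _).trans (map_inf f _ _).symm,
      (H'.funMap_inf _).trans (map_inf g _ _).symm⟩
  · exact ⟨v 0 ⊔ v 1, (H.funMap_sup _).trans (map_sup f _ _).symm,
      (H'.funMap_sup _).trans (map_sup g _ _).symm⟩

theorem isUltrahomogeneous [Countable M] (H : InterpretsBooleanAlgebra M)
    (hM : ∀ b : M, ¬ IsAtom b) : booleanAlgebraLanguage.IsUltrahomogeneous M := by
  rw [isUltrahomogeneous_iff_IsExtensionPair Structure.cg_of_countable]
  refine isExtensionPair_of_exists_mem_dom fun S hS e m => ?_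
  have : Finite (H.booleanSubalgebra S) := H.isUniformlyLocallyFinite.finite_of_fg hS
  let f := (H.booleanSubalgebra S).subtype
  let g := H.boundedLatticeHom H e
  obtain ⟨n, hn⟩ := exists_glue_eq_iff hM f g (H.booleanSubalgebra S).subtype_injective
    (fun x y hxy => Subtype.ext (congrArg Subtype.val (e.injective hxy))) m
  -- Pairs of elements of `S` index both tuples. The diagonal gives the inclusion of `S` on one side
  -- and `e` on the other, and `(⊤, ⊥)` gives `m` and `n`.
  have hd : SameDiagram booleanAlgebraLanguage (f.glue m) (g.glue n) := by
    refine ⟨hn, fun F v j h => ?_, fun R => Empty.elim R⟩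
    obtain ⟨b, h1, h2⟩ := H.exists_funMap_eq H (f.glue m) (g.glue n) F v
    exact h2.trans ((hn _ _).1 (h1.symm.trans h))
  let T := H.substructure ((⊤ : BooleanSubalgebra _).map (f.glue m))
  have hT : ∀ b, f.glue m b ∈ T := fun b => ⟨b, trivial, rfl⟩
  obtain ⟨E, hE⟩ := hd.exists_embedding T fun x =>
    ⟨fun ⟨b, _, hb⟩ => ⟨b, hb⟩, fun ⟨b, hb⟩ => hb ▸ hT b⟩
  have hle : ∀ s : S, f.glue m (⟨s, s.2⟩, ⟨s, s.2⟩) = s := fun s => f.glue_diag m ⟨s, s.2⟩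
  have hST : S ≤ T := fun s hs => ⟨_, trivial, hle ⟨s, hs⟩⟩
  have hmT : m ∈ T := ⟨_, trivial, f.glue_top_bot m⟩
  refine ⟨T, hST, E, hmT, fun s => ?_⟩
  have h1 := hE (⟨s, s.2⟩, ⟨s, s.2⟩) (hT _)
  rw [g.glue_diag] at h1
  refine Eq.trans ?_ h1
  exact congrArg E (Subtype.ext (hle s).symm)

end InterpretsBooleanAlgebra

theorem isCountableAtomlessBooleanAlgebra_iff {M : Type*} [booleanAlgebraLanguage.Structure M] :
    IsCountableAtomlessBooleanAlgebra M ↔ Countable M ∧ Nontrivial M ∧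
      ∃ _ : BooleanAlgebra M, InterpretsBooleanAlgebra M ∧ ∀ b : M, ¬ IsAtom b :=
  and_congr_right fun _ => and_congr_right fun _ => exists_congr fun _ =>
    ⟨fun ⟨h1, h2, h3, h4, h5, h6⟩ => ⟨⟨h1, h2, h3, h4, h5⟩, h6⟩,
      fun ⟨⟨h1, h2, h3, h4, h5⟩, h6⟩ => ⟨h1, h2, h3, h4, h5, h6⟩⟩

theorem IsCountableAtomlessBooleanAlgebra.infinite {M : Type*} [booleanAlgebraLanguage.Structure M]
    (h : IsCountableAtomlessBooleanAlgebra M) : Infinite M := by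
  obtain ⟨-, hnt, _, -, hM⟩ := isCountableAtomlessBooleanAlgebra_iff.1 h
  refine ⟨fun hfin => ?_⟩
  obtain ⟨a, ha, -⟩ := (eq_bot_or_exists_atom_le (⊤ : M)).resolve_left top_ne_bot
  exact hM a ha

theorem IsCountableAtomlessBooleanAlgebra.of_equiv {M N : Type*}
    [booleanAlgebraLanguage.Structure M] [booleanAlgebraLanguage.Structure N]
    (h : IsCountableAtomlessBooleanAlgebra M) (e : N ≃[booleanAlgebraLanguage] M) :
    IsCountableAtomlessBooleanAlgebra N := by
  rw [isCountableAtomlessBooleanAlgebra_iff] at h ⊢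
  obtain ⟨hc, hnt, _, H, hM⟩ := h
  let : BooleanAlgebra N := e.toEquiv.booleanAlgebra
  have hsymm : ∀ (x : N) (y : M), e x = y → x = e.toEquiv.symm y := fun x y h =>
    (e.toEquiv.symm_apply_eq.2 h.symm).symm
  refine ⟨e.injective.countable, e.toEquiv.nontrivial, inferInstance,
    ⟨fun a => ?_, fun a => ?_, fun a => ?_, fun a => ?_, fun a => ?_⟩, fun b hb => hM (e b) ?_⟩
  · exact hsymm _ _ ((e.map_fun _ _).trans (H.funMap_bot _))
  · exact hsymm _ _ ((e.map_fun _ _).trans (H.funMap_top _))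
  · exact hsymm _ _ ((e.map_fun _ _).trans (H.funMap_compl _))
  · exact hsymm _ _ ((e.map_fun _ _).trans (H.funMap_inf _))
  · exact hsymm _ _ ((e.map_fun _ _).trans (H.funMap_sup _))
  · let o : N ≃o M := ⟨e.toEquiv, Iff.rfl⟩
    exact (o.isAtom_iff b).2 hb

/-! ### A computable atomless Boolean algebra -/

section PeriodicSequences

/-- The Boolean algebra of periodic binary sequences. -/
def periodicSequences : BooleanSubalgebra (ℕ → Bool) where
  carrier := {x | ∃ p, 0 < p ∧ Function.Periodic x p}
  supClosed' := by
    rintro x ⟨p, hp, hx⟩ y ⟨q, hq, hy⟩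
    refine ⟨p * q, Nat.mul_pos hp hq, fun i => ?_⟩
    exact congrArg₂ (· ⊔ ·) ((Nat.mul_comm q p ▸ hx.nat_mul q) i) (hy.nat_mul p i)
  infClosed' := by
    rintro x ⟨p, hp, hx⟩ y ⟨q, hq, hy⟩
    refine ⟨p * q, Nat.mul_pos hp hq, fun i => ?_⟩
    exact congrArg₂ (· ⊓ ·) ((Nat.mul_comm q p ▸ hx.nat_mul q) i) (hy.nat_mul p i)
  compl_mem' := by
    rintro x ⟨p, hp, hx⟩
    exact ⟨p, hp, fun i => congrArg (·ᶜ) (hx i)⟩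
  bot_mem' := ⟨1, one_pos, fun _ => rfl⟩

theorem periodicSequences_not_isAtom (x : periodicSequences) : ¬ IsAtom x := by
  rintro ⟨hne, hmin⟩
  obtain ⟨x, p, hp, hx⟩ := x
  obtain ⟨i, hi⟩ : ∃ i, x i = true := by
    by_contra! h
    exact hne (Subtype.ext (funext fun i => by simpa using h i))
  -- Doubling the period makes room below `x`: meeting `x` with one residue class modulo `2 * p`
  -- keeps the value at `i` and removes the one at `i + p`, which periodicity had made equal.
  let z : ℕ → Bool := fun j => decide (j % (2 * p) = i % (2 * p))
  have hz : Function.Periodic z (2 * p) := fun j => by simp [z]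
  let y : periodicSequences := ⟨z, 2 * p, by positivity, hz⟩ ⊓ ⟨x, p, hp, hx⟩
  have hyi : y.1 i = true := by
    change (z i && x i) = true
    simp [z, hi]
  have hyp : y.1 (i + p) = false := by
    change (z (i + p) && x (i + p)) = false
    have : ¬ (i + p) % (2 * p) = i % (2 * p) := fun h => by
      have h' : (2 * p) ∣ p := (Nat.modEq_zero_iff_dvd).1
        (Nat.ModEq.add_left_cancel' i (show i + p ≡ i + 0 [MOD 2 * p] from h))
      have := Nat.le_of_dvd hp h'
      omega
    simp [z, this]
  have hbot := hmin y (lt_of_le_of_ne inf_le_right fun h => by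
    rw [h] at hyp
    exact Bool.false_ne_true (hyp.symm.trans ((hx i).trans hi)))
  rw [hbot] at hyi
  exact Bool.false_ne_true hyi

instance : booleanAlgebraLanguage.Structure periodicSequences where
  funMap := fun f a => match f with
    | .bot => ⊥
    | .top => ⊤
    | .compl => (a 0)ᶜ
    | .inf => a 0 ⊓ a 1
    | .sup => a 0 ⊔ a 1
  RelMap := fun R => Empty.elim R

/-- The periodic sequence with code `n`: the first component of `n` is the period minus one, and the
second one lists the values in its binary digits. -/
def periodicOfNat (n : ℕ) : periodicSequences :=
  ⟨fun i => n.unpair.2.testBit (i % (n.unpair.1 + 1)), n.unpair.1 + 1, Nat.succ_pos _,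
    fun i => by simp⟩

theorem periodicOfNat_surjective : Function.Surjective periodicOfNat := by
  rintro ⟨x, p, hp, hx⟩
  refine ⟨Nat.pair (p - 1) (∑ j ∈ Finset.range p with x j = true, 2 ^ j),
    Subtype.ext (funext fun i => ?_)⟩
  simp only [periodicOfNat, Nat.unpair_pair, Nat.sub_add_cancel hp]
  rw [Bool.eq_iff_iff, Nat.testBit_sum_two_pow, Finset.mem_filter, Finset.mem_range,
    hx.map_mod_nat]
  exact and_iff_right (Nat.mod_lt i hp)

instance : Countable periodicSequences := periodicOfNat_surjective.countable

theorem periodicOfNat_periodic (n : ℕ) :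
    Function.Periodic (periodicOfNat n).1 (n.unpair.1 + 1) := fun i => by
  simp [periodicOfNat]

theorem primrec_periodicOfNat : Primrec₂ fun n i => (periodicOfNat n).1 i :=
  Primrec.testBit.comp (Primrec.snd.comp (Primrec.unpair.comp Primrec.fst))
    (Primrec.nat_mod.comp Primrec.snd
      (Primrec.succ.comp (Primrec.fst.comp (Primrec.unpair.comp Primrec.fst))))

/-- Pointwise Boolean relations between coded periodic sequences are decidable. -/
theorem primrecPred_periodicOfNat_pointwise (F : Bool → Bool → Bool) :
    PrimrecPred fun p : ℕ × ℕ × ℕ => ∀ i, (periodicOfNat p.1).1 i =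
      F ((periodicOfNat p.2.1).1 i) ((periodicOfNat p.2.2).1 i) := by
  let per : ℕ → ℕ := fun n => n.unpair.1 + 1
  have hper : Primrec per := Primrec.succ.comp (Primrec.fst.comp Primrec.unpair)
  have hrel : PrimrecRel fun (i : ℕ) (p : ℕ × ℕ × ℕ) => (periodicOfNat p.1).1 i =
      F ((periodicOfNat p.2.1).1 i) ((periodicOfNat p.2.2).1 i) := by
    refine Primrec.eq.comp (primrec_periodicOfNat.comp (Primrec.fst.comp Primrec.snd) Primrec.fst)
      ((Primrec.dom_bool₂ F).comp
        (primrec_periodicOfNat.comp (Primrec.fst.comp (Primrec.snd.comp Primrec.snd)) Primrec.fst)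
        (primrec_periodicOfNat.comp (Primrec.snd.comp (Primrec.snd.comp Primrec.snd)) Primrec.fst))
  -- The product of the three periods is a common period, so checking the indices below it suffices.
  have hbound : Primrec fun p : ℕ × ℕ × ℕ => per p.1 * (per p.2.1 * per p.2.2) :=
    Primrec.nat_mul.comp (hper.comp Primrec.fst)
      (Primrec.nat_mul.comp (hper.comp (Primrec.fst.comp Primrec.snd))
        (hper.comp (Primrec.snd.comp Primrec.snd)))
  refine (hrel.forall_mem_list.comp (Primrec.list_range.comp hbound) Primrec.id).of_eq ?_
  rintro ⟨a, b, c⟩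
  refine ⟨fun h i => ?_, fun h i _ => h i⟩
  have hpos : 0 < per a * (per b * per c) := by positivity
  have ha : Function.Periodic (periodicOfNat a).1 (per a * (per b * per c)) := by
    rw [mul_comm]
    exact (periodicOfNat_periodic a).nat_mul _
  have hb : Function.Periodic (periodicOfNat b).1 (per a * (per b * per c)) := by
    rw [mul_left_comm, mul_comm]
    exact (periodicOfNat_periodic b).nat_mul _
  have hc : Function.Periodic (periodicOfNat c).1 (per a * (per b * per c)) := by
    rw [← mul_assoc]
    exact (periodicOfNat_periodic c).nat_mul _
  have hi : (periodicOfNat a).1 (i % (per a * (per b * per c))) =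
      F ((periodicOfNat b).1 (i % (per a * (per b * per c))))
        ((periodicOfNat c).1 (i % (per a * (per b * per c)))) :=
    h _ (List.mem_range.2 (Nat.mod_lt i hpos))
  rw [ha.map_mod_nat, hb.map_mod_nat, hc.map_mod_nat] at hi
  exact hi

theorem interpretsBooleanAlgebra_periodicSequences :
    InterpretsBooleanAlgebra periodicSequences :=
  ⟨fun _ => rfl, fun _ => rfl, fun _ => rfl, fun _ => rfl, fun _ => rfl⟩

theorem IsCountableAtomlessBooleanAlgebra.exists_computable_presentation :
    ∃ A : ComputableStructure booleanAlgebraLanguage, IsCountableAtomlessBooleanAlgebra A := by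
  have hB : IsCountableAtomlessBooleanAlgebra periodicSequences :=
    isCountableAtomlessBooleanAlgebra_iff.2 ⟨inferInstance,
      ⟨⊥, ⊤, fun h => Bool.false_ne_true (congrFun (congrArg Subtype.val h) 0)⟩, inferInstance,
      interpretsBooleanAlgebra_periodicSequences, periodicSequences_not_isAtom⟩
  -- A suitable binary `F` covers equality and each of the five operations; for those of lower
  -- arity, `F` ignores arguments.
  have hcomp : ∀ (F : Bool → Bool → Bool) {α : Type} [Primcodable α] (a b c : α → ℕ)
      (_ : Computable a) (_ : Computable b) (_ : Computable c) (y : α → periodicSequences)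
      (_ : ∀ x i, (y x).1 i = F ((periodicOfNat (b x)).1 i) ((periodicOfNat (c x)).1 i)),
      ComputablePred fun x => periodicOfNat (a x) = y x := by
    intro F α _ a b c ha hb hc y hy
    refine ((primrecPred_periodicOfNat_pointwise F).computablePred.comp
      (ha.pair (hb.pair hc))).of_eq fun x => ?_
    rw [Subtype.ext_iff, funext_iff]
    exact forall_congr' fun i => by rw [hy]
  obtain ⟨A, ⟨e⟩⟩ := ComputableStructure.exists_equiv_of_numbering (L := booleanAlgebraLanguage)
    periodicOfNat periodicOfNat_surjective
    (hcomp (fun x _ => x) _ _ _ Computable.snd Computable.fst Computable.fst _ fun _ _ => rfl) (by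
      have happ : ∀ {n : ℕ} (i : Fin n), Computable fun p : (Fin n → ℕ) × ℕ => p.1 i :=
        fun i => (Computable.fin_apply i).comp Computable.fst
      rintro _ (_ | _ | _ | _ | _)
      · exact hcomp (fun _ _ => false) _ _ _ Computable.snd Computable.snd Computable.snd _
          fun _ _ => rfl
      · exact hcomp (fun _ _ => true) _ _ _ Computable.snd Computable.snd Computable.snd _
          fun _ _ => rfl
      · exact hcomp (fun x _ => !x) _ _ _ Computable.snd (happ 0) (happ 0) _ fun _ _ => rfl
      · exact hcomp (fun x y => x && y) _ _ _ Computable.snd (happ 0) (happ 1) _ fun _ _ => rfl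
      · exact hcomp (fun x y => x || y) _ _ _ Computable.snd (happ 0) (happ 1) _ fun _ _ => rfl)
    (fun R => Empty.elim R)
  exact ⟨A, hB.of_equiv e⟩

end PeriodicSequences

/-! ### The main theorem -/

theorem mainTheorem10 :
    (∀ (L : FirstOrder.Language.{u, v}) [Finite L.Symbols] (A : ComputableStructure L),
      Infinite A → IsUniformlyLocallyFinite L A → L.IsUltrahomogeneous A →
      ∀ C : Set ℕ, IsCohesive C → Nonempty (A ≃[L] CohesivePower A C)) ∧
    ((∃ A : ComputableStructure strictOrderLanguage, Nonempty (A ≃[strictOrderLanguage] ℚ)) ∧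
      ∀ A : ComputableStructure strictOrderLanguage, Nonempty (A ≃[strictOrderLanguage] ℚ) →
        Infinite A ∧ IsUniformlyLocallyFinite strictOrderLanguage A ∧
        strictOrderLanguage.IsUltrahomogeneous A ∧
        ∀ C : Set ℕ, IsCohesive C →
          Nonempty (A ≃[strictOrderLanguage] CohesivePower A C)) ∧
    ((∃ A : ComputableStructure FirstOrder.Language.graph, IsRadoGraph A) ∧
      ∀ A : ComputableStructure FirstOrder.Language.graph, IsRadoGraph A →
        Infinite A ∧ IsUniformlyLocallyFinite FirstOrder.Language.graph A ∧
        FirstOrder.Language.graph.IsUltrahomogeneous A ∧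
        ∀ C : Set ℕ, IsCohesive C →
          Nonempty (A ≃[FirstOrder.Language.graph] CohesivePower A C)) ∧
    ((∃ A : ComputableStructure booleanAlgebraLanguage, IsCountableAtomlessBooleanAlgebra A) ∧
      ∀ A : ComputableStructure booleanAlgebraLanguage, IsCountableAtomlessBooleanAlgebra A →
        Infinite A ∧ IsUniformlyLocallyFinite booleanAlgebraLanguage A ∧
        booleanAlgebraLanguage.IsUltrahomogeneous A ∧
        ∀ C : Set ℕ, IsCohesive C →
          Nonempty (A ≃[booleanAlgebraLanguage] CohesivePower A C)) := by
  refine ⟨fun L _ A _ hA hu C hC => CohesivePower.nonempty_equiv hA hu hC,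
    ⟨strictOrderLanguage.exists_computable_presentation_rat, fun A ⟨e⟩ => ?_⟩,
    ⟨IsRadoGraph.exists_computable_presentation, fun A hA => ?_⟩,
    ⟨IsCountableAtomlessBooleanAlgebra.exists_computable_presentation, fun A hA => ?_⟩⟩
  · have hulf : IsUniformlyLocallyFinite strictOrderLanguage A :=
      isUniformlyLocallyFinite_of_isRelational
    have hu := strictOrderLanguage.isUltrahomogeneous_rat.of_equiv e.symm
    exact ⟨Infinite.of_injective e.symm e.symm.injective, hulf, hu,
      fun C hC => CohesivePower.nonempty_equiv hulf hu hC⟩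
  · have hulf : IsUniformlyLocallyFinite Language.graph A :=
      isUniformlyLocallyFinite_of_isRelational
    exact ⟨hA.infinite, hulf, hA.isUltrahomogeneous,
      fun C hC => CohesivePower.nonempty_equiv hulf hA.isUltrahomogeneous hC⟩
  · obtain ⟨hc, -, _, H, hM⟩ := isCountableAtomlessBooleanAlgebra_iff.1 hA
    exact ⟨hA.infinite, H.isUniformlyLocallyFinite, H.isUltrahomogeneous hM,
      fun C hC => CohesivePower.nonempty_equiv H.isUniformlyLocallyFinite
        (H.isUltrahomogeneous hM) hC⟩
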